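/- **Setting.** Let $m\ge 1$, $n\ge 1$, $r\ge 0$, let $P(\lambda)=\sum_{j=0}^m\lambda^jA_j$ with $A_j\in\mathbb C^{n\times n}$, $A_m\ne 0$, and let $G(\lambda)=P(\lambda)+C(\lambda E-A)^{-1}B$ be a minimal realization, i.e. $E\in\mathbb C^{r\times r}$ is nonsingular, $A\in\mathbb C^{r\times r}$, $B\in\mathbb C^{r\times n}$, $C\in\mathbb C^{n\times r}$, and $r$ is smallest among all realizations of $G$ of this form. Put $\mathcal S(\lambda)=\begin{bmatrix}P(\lambda)&C\\ B&A-\lambda E\end{bmatrix}$. Let $e_k$ be the $k$-th column of $I_m$. **Elementary and Fiedler matrices.** For $X\in\mathbb C^{n\times n}$ let $M_0(X)=\mathrm{diag}(I_{(m-1)n},X)$, $M_{-m}(X)=\mathrm{diag}(X,I_{(m-1)n})$ and, for $1\le i\le m-1$, $$M_i(X)=\mathrm{diag}\Big(I_{(m-i-1)n},\begin{bmatrix}X&I_n\\I_n&0\end{bmatrix},I_{(i-1)n}\Big),\qquad M_{-i}(X)=\mathrm{diag}\Big(I_{(m-i-1)n},\begin{bmatrix}0&I_n\\I_n&X\end{bmatrix},I_{(i-1)n}\Big).$$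 Put $\mathbb M_i(X)=\mathrm{diag}(M_i(X),I_r)$ for $-m\le i\le m-1$, and $$\mathbb M^{\mathcal S}_0=\begin{bmatrix}M_0(-A_0)&-e_m\otimes C\\-e_m^T\otimes B&-A\end{bmatrix},\quad \mathbb M^{\mathcal S}_{-m}=\mathrm{diag}(M_{-m}(A_m),-E),\quad \mathbb M^{\mathcal S}_i=\mathrm{diag}(M_i(-A_i),I_r),\quad \mathbb M^{\mathcal S}_{-i}=(\mathbb M^{\mathcal S}_i)^{-1}\quad(1\le i\le m-1).$$ For a tuple of indices $\mathbf t=(t_1,\dots,t_k)$ put $\mathbb M^{\mathcal S}_{\mathbf t}=\mathbb M^{\mathcal S}_{t_1}\cdots\mathbb M^{\mathcal S}_{t_k}$ and, for a tuple $X=(X_1,\dots,X_k)$ of $n\times n$ matrices (a matrix assignment for $\mathbf t$), $\mathbb M_{\mathbf t}(X)=\mathbb M_{t_1}(X_1)\cdots\mathbb M_{t_k}(X_k)$. The assignment is nonsingular if $X_j$ is nonsingular whenever $t_j\in\{0,-m\}$. **Index tuples.** A tuple satisfies the successor infix property (SIP) if between any two occurrences of an index $i$ there is an occurrence of $i+1$.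 A subtuple is obtained by deleting entries. For a tuple $\alpha$ containing $0$, $c_0(\alpha)$ is the largest $p$ such that $(0,1,\dots,p)$ is a subtuple of $\alpha$, and $i_0(\alpha)$ the largest $p$ such that $(p,\dots,1,0)$ is a subtuple of $\alpha$. For a permutation $\alpha$ of $\{0,\dots,m-1\}$, $c(\alpha)$ (resp. $i(\alpha)$) is the number of $i\in\{0,\dots,m-2\}$ that stand to the left (resp. to the right) of $i+1$ in $\alpha$. **GFPR.** Let $0\le h\le m-1$, let $\sigma$ and $\tau$ be permutations (as tuples) of $\{0,\dots,h\}$ and $\{-m,\dots,-h-1\}$, let $\sigma_1,\sigma_2$ be tuples of indices from $\{0,\dots,h-1\}$ and $\tau_1,\tau_2$ tuples of indices from $\{-m,\dots,-h-2\}$ such that $(\sigma_1,\sigma,\sigma_2)$ and $(\tau_1,\tau,\tau_2)$ satisfy the SIP, and let $X_1,X_2,Y_1,Y_2$ be nonsingular matrix assignments for $\sigma_1,\sigma_2,\tau_1,\tau_2$. Let $$\mathbb L(\lambda)=\mathbb M_{\tau_1}(Y_1)\,\mathbb M_{\sigma_1}(X_1)\,(\lambda\mathbb M^{\mathcal S}_\tau-\mathbb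 M^{\mathcal S}_\sigma)\,\mathbb M_{\sigma_2}(X_2)\,\mathbb M_{\tau_2}(Y_2).$$ **Minimal bases.** For a matrix polynomial $M(\lambda)$, a right (resp. left) minimal basis is a matrix polynomial $Z(\lambda)$ whose columns, listed with nondecreasing degrees, form a basis of $\{x\in\mathbb C(\lambda)^k: Mx=0\}$ (resp. $\{y\in\mathbb C(\lambda)^k: y^TM=0\}$), $k$ being the number of columns (resp. rows) of $M$, with least sum of column degrees among all polynomial bases of that space; the degrees of its columns are the right (resp. left) minimal indices of $M$. **Theorem 5.3.** (a) Let $Z(\lambda)=\begin{bmatrix}Z_{mn}(\lambda)\\Z_r(\lambda)\end{bmatrix}$ be an $(mn+r)\times p$ matrix polynomial, where $Z_{mn}$ has $mn$ rows and $Z_r$ has $r$ rows. If $Z$ is a right (resp. left) minimal basis of $\mathbb L(\lambda)$, then $$\begin{bmatrix}(e^T_{m-c_0(\sigma,\sigma_2)}\otimes I_n)Z_{mn}(\lambda)\\ Z_r(\lambda)\end{bmatrix}\qquad\Big(\text{resp. }\begin{bmatrix}(e^T_{m-i_0(\sigma_1,\sigma)}\otimes I_n)Z_{mn}(\lambda)\\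 Z_r(\lambda)\end{bmatrix}\Big)$$ is a right (resp. left) minimal basis of $\mathcal S(\lambda)$. (b) Write $\tau=(\tau_l,-m,\tau_r)$ and $\alpha=(-\mathrm{rev}\,\tau_l,\ \sigma,\ -\mathrm{rev}\,\tau_r)$, where $\mathrm{rev}$ reverses a tuple; $\alpha$ is a permutation of $\{0,\dots,m-1\}$. If $\varepsilon_1\le\dots\le\varepsilon_p$ are the right (resp. left) minimal indices of $\mathbb L(\lambda)$, then $\varepsilon_1-i(\alpha)\le\dots\le\varepsilon_p-i(\alpha)$ (resp. $\varepsilon_1-c(\alpha)\le\dots\le\varepsilon_p-c(\alpha)$) are the right (resp. left) minimal indices of $\mathcal S(\lambda)$. -/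

import Mathlib

open Polynomial

namespace GFPR

noncomputable section

/-! ### Null spaces, polynomial bases, minimal bases and minimal indices -/

/-- A matrix polynomial, viewed as a rational matrix. -/
def toRat {ι κ : Type*} (M : Matrix ι κ ℂ[X]) : Matrix ι κ (RatFunc ℂ) :=
  M.map (algebraMap ℂ[X] (RatFunc ℂ))

/-- The right null space `{x | G x = 0}` of a rational matrix over the field `ℂ(λ)`. -/
def rightNull {ι κ : Type*} [Fintype ι] [Fintype κ] (G : Matrix ι κ (RatFunc ℂ)) :
    Submodule (RatFunc ℂ) (κ → RatFunc ℂ) :=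
  LinearMap.ker G.mulVecLin

/-- The left null space `{y | yᵀ G = 0}` of a rational matrix over the field `ℂ(λ)`. -/
def leftNull {ι κ : Type*} [Fintype ι] [Fintype κ] (G : Matrix ι κ (RatFunc ℂ)) :
    Submodule (RatFunc ℂ) (ι → RatFunc ℂ) :=
  LinearMap.ker G.vecMulLinear

/-- The degree of the `j`-th column of a matrix polynomial: the largest degree of its entries. -/
def colDegree {κ : Type*} [Fintype κ] {p : ℕ} (Z : Matrix κ (Fin p) ℂ[X]) (j : Fin p) : ℕ :=
  Finset.univ.sup fun k => (Z k j).natDegree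

/-- The columns of `Z` (vector polynomials) form a basis of the subspace `N` of `ℂ(λ)^κ`. -/
def IsPolynomialBasis {κ : Type*} (N : Submodule (RatFunc ℂ) (κ → RatFunc ℂ)) {p : ℕ}
    (Z : Matrix κ (Fin p) ℂ[X]) : Prop :=
  LinearIndependent (RatFunc ℂ) (fun j : Fin p => (toRat Z).col j) ∧
    Submodule.span (RatFunc ℂ) (Set.range fun j : Fin p => (toRat Z).col j) = N

/-- The order of a polynomial basis: the sum of the degrees of its members. -/
def order {κ : Type*} [Fintype κ] {p : ℕ} (Z : Matrix κ (Fin p) ℂ[X]) : ℕ :=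
  ∑ j, colDegree Z j

/-- The columns of `Z`, listed with nondecreasing degrees, form a polynomial basis of `N` whose
order is least among all polynomial bases of `N`. -/
structure IsMinimalBasis {κ : Type*} [Fintype κ] (N : Submodule (RatFunc ℂ) (κ → RatFunc ℂ))
    {p : ℕ} (Z : Matrix κ (Fin p) ℂ[X]) : Prop where
  basis : IsPolynomialBasis N Z
  sorted : Monotone (colDegree Z)
  order_le : ∀ (q : ℕ) (W : Matrix κ (Fin q) ℂ[X]), IsPolynomialBasis N W → order Z ≤ order W

/-- Right minimal basis of a matrix polynomial. -/
def IsRightMinimalBasis {ι κ : Type*} [Fintype ι] [Fintype κ] (M : Matrix ι κ ℂ[X]) {p : ℕ}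
    (Z : Matrix κ (Fin p) ℂ[X]) : Prop :=
  IsMinimalBasis (rightNull (toRat M)) Z

/-- Left minimal basis of a matrix polynomial. -/
def IsLeftMinimalBasis {ι κ : Type*} [Fintype ι] [Fintype κ] (M : Matrix ι κ ℂ[X]) {p : ℕ}
    (Z : Matrix ι (Fin p) ℂ[X]) : Prop :=
  IsMinimalBasis (leftNull (toRat M)) Z

/-- `ε 0 ≤ ε 1 ≤ ⋯` are the right minimal indices of `M`: the column degrees of a right minimal
basis. They are integer-valued so that differences are not truncated. -/
def IsRightMinimalIndices {ι κ : Type*} [Fintype ι] [Fintype κ] (M : Matrix ι κ ℂ[X]) {p : ℕ}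
    (ε : Fin p → ℤ) : Prop :=
  ∃ Z : Matrix κ (Fin p) ℂ[X], IsRightMinimalBasis M Z ∧ ∀ j, (colDegree Z j : ℤ) = ε j

/-- `ε 0 ≤ ε 1 ≤ ⋯` are the left minimal indices of `M`. -/
def IsLeftMinimalIndices {ι κ : Type*} [Fintype ι] [Fintype κ] (M : Matrix ι κ ℂ[X]) {p : ℕ}
    (ε : Fin p → ℤ) : Prop :=
  ∃ Z : Matrix ι (Fin p) ℂ[X], IsLeftMinimalBasis M Z ∧ ∀ j, (colDegree Z j : ℤ) = ε j

/-! ### Realizations and system matrices -/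

/-- The data of a realization `G(λ) = ∑_{j=0}^m λ^j A_j + C (λ E - A)⁻¹ B` with `E` nonsingular;
`A_j` is `coeff j`, and only `coeff 0, …, coeff m` are ever used. -/
structure Realization (m n r : ℕ) where
  coeff : ℕ → Matrix (Fin n) (Fin n) ℂ
  A : Matrix (Fin r) (Fin r) ℂ
  E : Matrix (Fin r) (Fin r) ℂ
  B : Matrix (Fin r) (Fin n) ℂ
  C : Matrix (Fin n) (Fin r) ℂ
  E_nonsingular : E.det ≠ 0

/-- A complex matrix as a constant matrix polynomial. -/
def const {ι κ : Type*} (M : Matrix ι κ ℂ) : Matrix ι κ ℂ[X] := M.map Polynomial.C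

namespace Realization

variable {m n r : ℕ}

/-- `P(λ) = ∑_{j=0}^m λ^j A_j`. -/
def polyPart (R : Realization m n r) : Matrix (Fin n) (Fin n) ℂ[X] :=
  ∑ j ∈ Finset.range (m + 1), (X ^ j : ℂ[X]) • const (R.coeff j)

/-- The rational matrix `P(λ) + C (λ E - A)⁻¹ B`. -/
def transfer (R : Realization m n r) : Matrix (Fin n) (Fin n) (RatFunc ℂ) :=
  toRat R.polyPart +
    toRat (const R.C) * (toRat ((X : ℂ[X]) • const R.E - const R.A))⁻¹ * toRat (const R.B)

/-- The realization has the least state dimension among all realizations of the same rational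
matrix. -/
def IsMinimal (R : Realization m n r) : Prop :=
  ∀ (m' r' : ℕ) (R' : Realization m' n r'), R'.transfer = R.transfer → r ≤ r'

/-- The system matrix `[P(λ), C; B, A - λ E]`. -/
def systemMatrix (R : Realization m n r) : Matrix (Fin n ⊕ Fin r) (Fin n ⊕ Fin r) ℂ[X] :=
  Matrix.fromBlocks R.polyPart (const R.C) (const R.B) (const R.A - (X : ℂ[X]) • const R.E)

end Realization

/-! ### Elementary matrices and Fiedler matrices -/

/-- `e_k ⊗ C`, where `e_k` is the `k`-th column (counted from 1) of the `m × m` identity. -/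
def blockCol (m : ℕ) {n : ℕ} {κ R : Type*} [Zero R] (k : ℤ) (C : Matrix (Fin n) κ R) :
    Matrix (Fin m × Fin n) κ R :=
  Matrix.of fun a j => if (a.1 : ℤ) + 1 = k then C a.2 j else 0

/-- `e_kᵀ ⊗ B`, where `e_k` is the `k`-th column (counted from 1) of the `m × m` identity. -/
def blockRow (m : ℕ) {n : ℕ} {κ R : Type*} [Zero R] (k : ℤ) (B : Matrix κ (Fin n) R) :
    Matrix κ (Fin m × Fin n) R :=
  Matrix.of fun j a => if (a.1 : ℤ) + 1 = k then B j a.2 else 0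

/-- The `m × m` array of `n × n` blocks of the elementary matrix `M_i(X)`, `-m ≤ i ≤ m - 1`.
For `i = 0` (`i = -m`) it is the identity with the last (first) diagonal block replaced by `X`.
For `0 < |i| < m` it is the identity except in the block rows and columns `m - |i|`, `m - |i| + 1`
(counted from 1), where it is `[X, I; I, 0]` if `i > 0` and `[0, I; I, X]` if `i < 0`. -/
def elemBlocks (m : ℕ) {n : ℕ} (i : ℤ) (X : Matrix (Fin n) (Fin n) ℂ) :
    Matrix (Fin m) (Fin m) (Matrix (Fin n) (Fin n) ℂ) :=
  if i = 0 then Matrix.diagonal fun a => if (a : ℕ) + 1 = m then X else 1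
  else if i = -(m : ℤ) then Matrix.diagonal fun a => if (a : ℕ) = 0 then X else 1
  else Matrix.of fun a b =>
    if (a : ℕ) + 1 + i.natAbs = m ∧ (b : ℕ) + 1 + i.natAbs = m then (if 0 < i then X else 0)
    else if (a : ℕ) + i.natAbs = m ∧ (b : ℕ) + i.natAbs = m then (if 0 < i then 0 else X)
    else if (a : ℕ) + 1 + i.natAbs = m ∧ (b : ℕ) + i.natAbs = m then 1
    else if (a : ℕ) + i.natAbs = m ∧ (b : ℕ) + 1 + i.natAbs = m then 1
    else if a = b then 1 else 0

/-- The `mn × mn` elementary matrix `M_i(X)`. -/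
def elem (m : ℕ) {n : ℕ} (i : ℤ) (X : Matrix (Fin n) (Fin n) ℂ) :
    Matrix (Fin m × Fin n) (Fin m × Fin n) ℂ :=
  Matrix.comp (Fin m) (Fin m) (Fin n) (Fin n) ℂ (elemBlocks m i X)

/-- The `(mn + r) × (mn + r)` elementary matrix `diag(M_i(X), I_r)`. -/
def bigElem (m : ℕ) {n : ℕ} (r : ℕ) (i : ℤ) (X : Matrix (Fin n) (Fin n) ℂ) :
    Matrix ((Fin m × Fin n) ⊕ Fin r) ((Fin m × Fin n) ⊕ Fin r) ℂ :=
  Matrix.fromBlocks (elem m i X) 0 0 1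

namespace Realization

variable {m n r : ℕ}

/-- The Fiedler matrix of `P(λ)`: `M_i(-A_i)` for `i ≥ 0` and `M_i(A_{-i})` for `i < 0`. -/
def fiedlerP (R : Realization m n r) (i : ℤ) : Matrix (Fin m × Fin n) (Fin m × Fin n) ℂ :=
  if 0 ≤ i then elem m i (-R.coeff i.natAbs) else elem m i (R.coeff i.natAbs)

/-- The Fiedler matrices of the system matrix: index `0` carries `B`, `C`, `A`, index `-m`
carries `E`, index `i = 1, …, m - 1` is `diag(M_i(-A_i), I_r)`, and index `-i` is its inverse. -/
def fiedlerS (R : Realization m n r) (i : ℤ) :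
    Matrix ((Fin m × Fin n) ⊕ Fin r) ((Fin m × Fin n) ⊕ Fin r) ℂ :=
  if i = 0 then
    Matrix.fromBlocks (R.fiedlerP 0) (-blockCol m (m : ℤ) R.C) (-blockRow m (m : ℤ) R.B) (-R.A)
  else if i = -(m : ℤ) then Matrix.fromBlocks (R.fiedlerP i) 0 0 (-R.E)
  else if 0 < i then Matrix.fromBlocks (R.fiedlerP i) 0 0 1
  else (Matrix.fromBlocks (R.fiedlerP (-i)) 0 0 1)⁻¹

/-- The product of the Fiedler matrices of the system matrix along an index tuple. -/
def fiedlerSProd (R : Realization m n r) (t : List ℤ) :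
    Matrix ((Fin m × Fin n) ⊕ Fin r) ((Fin m × Fin n) ⊕ Fin r) ℂ :=
  (t.map R.fiedlerS).prod

end Realization

/-- The product of the big elementary matrices along an index tuple `t` with the matrices of the
assignment `X` put in the corresponding positions. -/
def bigElemProd (m : ℕ) {n : ℕ} (r : ℕ) (t : List ℤ) (X : List (Matrix (Fin n) (Fin n) ℂ)) :
    Matrix ((Fin m × Fin n) ⊕ Fin r) ((Fin m × Fin n) ⊕ Fin r) ℂ :=
  (List.zipWith (bigElem m r) t X).prod

/-- `X` is a nonsingular matrix assignment for `t`: it has one matrix for each position of `t`,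
and the matrices in the positions occupied by the indices `0` and `-m` are nonsingular. -/
def IsNonsingularAssignment (m : ℕ) {n : ℕ} (t : List ℤ) (X : List (Matrix (Fin n) (Fin n) ℂ)) :
    Prop :=
  X.length = t.length ∧ ∀ q ∈ t.zip X, q.1 = 0 ∨ q.1 = -(m : ℤ) → q.2.det ≠ 0

/-! ### Index tuples -/

/-- The tuple `t` lists every integer of `{a, …, b}` exactly once and nothing else. -/
def IsPermutationOf (t : List ℤ) (a b : ℤ) : Prop :=
  t.Nodup ∧ ∀ i, i ∈ t ↔ a ≤ i ∧ i ≤ b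

/-- Successor infix property: between two occurrences of `i` there is an occurrence of `i + 1`. -/
def SIP (t : List ℤ) : Prop :=
  ∀ a b : Fin t.length, a < b → t.get a = t.get b →
    ∃ c : Fin t.length, a < c ∧ c < b ∧ t.get c = t.get a + 1

/-- The string `(t, t + 1, …, t + p)`. -/
def run (t : ℤ) (p : ℕ) : List ℤ := (List.range (p + 1)).map fun k => t + (k : ℤ)

/-- `c_t(α)`: the largest `p` such that `(t, t + 1, …, t + p)` is a subtuple of `α`, and `-1` if
`t` does not occur in `α`. -/
def consecutionsAt (t : ℤ) (α : List ℤ) : ℤ :=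
  if t ∈ α then (Nat.findGreatest (fun p => (run t p).Sublist α) α.length : ℤ) else -1

/-- `i_t(α)`: the largest `p` such that `(t + p, …, t + 1, t)` is a subtuple of `α`, and `-1` if
`t` does not occur in `α`. -/
def inversionsAt (t : ℤ) (α : List ℤ) : ℤ :=
  if t ∈ α then (Nat.findGreatest (fun p => (run t p).reverse.Sublist α) α.length : ℤ) else -1

/-- `c(α)`: the number of `i` such that `i` and `i + 1` both occur in the permutation `α`, with
`i` to the left of `i + 1`. -/
def totalConsecutions (α : List ℤ) : ℕ :=
  (α.toFinset.filter fun i => List.Sublist [i, i + 1] α).card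

/-- `i(α)`: the number of `i` such that `i` and `i + 1` both occur in the permutation `α`, with
`i` to the right of `i + 1`. -/
def totalInversions (α : List ℤ) : ℕ :=
  (α.toFinset.filter fun i => List.Sublist [i + 1, i] α).card

/-- `-rev(t)`. -/
def negRev (t : List ℤ) : List ℤ := t.reverse.map fun i => -i

/-! ### Generalized Fiedler pencils with repetition -/

/-- The conditions on the index tuples of a generalized Fiedler pencil with repetition. -/
structure IsGFPRIndices (m h : ℕ) (σ τ σ₁ σ₂ τ₁ τ₂ : List ℤ) : Prop where
  h_lt : h < m
  perm_σ : IsPermutationOf σ 0 h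
  perm_τ : IsPermutationOf τ (-(m : ℤ)) (-(h : ℤ) - 1)
  mem_σ₁ : ∀ i ∈ σ₁, 0 ≤ i ∧ i ≤ (h : ℤ) - 1
  mem_σ₂ : ∀ i ∈ σ₂, 0 ≤ i ∧ i ≤ (h : ℤ) - 1
  mem_τ₁ : ∀ i ∈ τ₁, -(m : ℤ) ≤ i ∧ i ≤ -(h : ℤ) - 2
  mem_τ₂ : ∀ i ∈ τ₂, -(m : ℤ) ≤ i ∧ i ≤ -(h : ℤ) - 2
  sip_σ : SIP (σ₁ ++ σ ++ σ₂)
  sip_τ : SIP (τ₁ ++ τ ++ τ₂)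

/-- The pencil `𝕄_{τ₁}(Y₁) 𝕄_{σ₁}(X₁) (λ 𝕄^S_τ - 𝕄^S_σ) 𝕄_{σ₂}(X₂) 𝕄_{τ₂}(Y₂)`. -/
def pencil {m n r : ℕ} (R : Realization m n r) (σ τ σ₁ σ₂ τ₁ τ₂ : List ℤ)
    (X₁ X₂ Y₁ Y₂ : List (Matrix (Fin n) (Fin n) ℂ)) :
    Matrix ((Fin m × Fin n) ⊕ Fin r) ((Fin m × Fin n) ⊕ Fin r) ℂ[X] :=
  const (bigElemProd m r τ₁ Y₁) * const (bigElemProd m r σ₁ X₁) *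
    ((X : ℂ[X]) • const (R.fiedlerSProd τ) - const (R.fiedlerSProd σ)) *
    const (bigElemProd m r σ₂ X₂) * const (bigElemProd m r τ₂ Y₂)

end

end GFPR

open GFPR

/-! Up to constant nonsingular factors on both sides, the pencil is the Fiedler pencil `λ 𝕄^S_{-m} -
𝕄^S_α`: since `𝕄^S_{-i}` inverts `𝕄^S_i`, the parts of `τ` on either side of `-m` can be pulled out
and absorbed into `σ` (`fiedlerPencil_factor`).

A null vector `y` of the Fiedler pencil is found by following its blocks through the product `𝕄^S_α`
(`exists_wires`). Let `u` be block 0 just before the factor of index 0 acts, and `w` the state part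
of `y`. The value of block `j` entering factor `j` is `u` times a power of `λ` that grows by one at
each inversion. The value leaving it is, up to a power of `λ` that grows at each consecution, a
partial sum of `-P(λ)u - Cw`. The two exponents add up to `j`, so the top block row says `P(λ)u + Cw
= 0`, and the state row gives the other half of the system. Conversely, `(u, w)` determines `y`, and
the required division by a power of `λ` is exact because the partial sums equal tails of `P(λ)u`.
The top block of `y` is `λ^{i(α)} u`, no other block has larger degree, and `deg w < deg u` if `w ≠
0` since `E` is nonsingular. Hence `y ↦ (u, w)` is bijective on polynomial null vectors and lowers
degrees by exactly `i(α)` (`fiedlerPencil_null`, `exists_fiedlerPencil_null`). Such a map carries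
minimal bases to minimal bases (`IsRightMinimalBasis.transfer`).

It remains to see `u` inside a null vector `x` of the given pencil. The SIP ensures that block 0,
traced back through the factors to the right of the index 0, is copied from block 1, then from block
2, and so on, without ever being mixed; it ends at block `c₀(σ, σ₂)` (`reg_gates_greedyRun`). The
left half follows by transposition, which reverses tuples and exchanges consecutions with
inversions. -/

namespace GFPR

/-! ### Transfer of minimal bases along degree-shifting bijections of null spaces. -/

section Transfer

/-- The largest degree of the entries of a vector polynomial. -/
noncomputable def vecDegree {κ : Type*} [Fintype κ] (v : κ → ℂ[X]) : ℕ :=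
  Finset.univ.sup fun k => (v k).natDegree

theorem vecDegree_le_iff {κ : Type*} [Fintype κ] {v : κ → ℂ[X]} {d : ℕ} :
    vecDegree v ≤ d ↔ ∀ k, (v k).natDegree ≤ d := by
  simp [vecDegree, Finset.sup_le_iff]

theorem natDegree_le_vecDegree {κ : Type*} [Fintype κ] (v : κ → ℂ[X]) (k : κ) :
    (v k).natDegree ≤ vecDegree v :=
  vecDegree_le_iff.1 le_rfl k

theorem colDegree_eq_vecDegree {κ : Type*} [Fintype κ] {p : ℕ} (Z : Matrix κ (Fin p) ℂ[X])
    (j : Fin p) : colDegree Z j = vecDegree (Z.col j) := rfl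

/-- Coefficientwise embedding of vector polynomials into rational vectors. -/
noncomputable def ratVec {κ : Type*} (v : κ → ℂ[X]) : κ → RatFunc ℂ :=
  fun k => algebraMap ℂ[X] (RatFunc ℂ) (v k)

theorem ratVec_injective {κ : Type*} : Function.Injective (ratVec (κ := κ)) := fun v w h => by
  funext k
  exact IsFractionRing.injective ℂ[X] (RatFunc ℂ) (congrFun h k)

@[simp] theorem ratVec_zero {κ : Type*} : ratVec (0 : κ → ℂ[X]) = 0 := by
  funext k; simp [ratVec]

theorem ratVec_eq_zero {κ : Type*} {v : κ → ℂ[X]} : ratVec v = 0 ↔ v = 0 := by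
  rw [← ratVec_zero]; exact ratVec_injective.eq_iff

theorem toRat_mulVec {ι κ : Type*} [Fintype κ] (M : Matrix ι κ ℂ[X]) (v : κ → ℂ[X]) :
    (toRat M).mulVec (ratVec v) = ratVec (M.mulVec v) := by
  funext i
  simp [toRat, ratVec, Matrix.mulVec, dotProduct]

/-- Clearing denominators: facts about polynomial null vectors extend to the whole rational null
space. -/
theorem exists_ratVec_smul {κ : Type*} [Finite κ] (v : κ → RatFunc ℂ) :
    ∃ q : RatFunc ℂ, q ≠ 0 ∧ ∃ w : κ → ℂ[X], q • v = ratVec w := by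
  obtain ⟨b, hb⟩ := IsLocalization.exist_integer_multiples_of_finite (nonZeroDivisors ℂ[X]) v
  choose w hw using hb
  refine ⟨algebraMap ℂ[X] (RatFunc ℂ) b, ?_, w, ?_⟩
  · exact IsLocalization.to_map_ne_zero_of_mem_nonZeroDivisors _ le_rfl b.2
  · funext k
    simp only [ratVec, hw, Pi.smul_apply, smul_eq_mul]
    rw [Algebra.smul_def]

theorem ratVec_mem_rightNull {ι κ : Type*} [Fintype ι] [Fintype κ] {M : Matrix ι κ ℂ[X]}
    {v : κ → ℂ[X]} : ratVec v ∈ rightNull (toRat M) ↔ M.mulVec v = 0 := by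
  rw [rightNull, LinearMap.mem_ker, Matrix.mulVecLin_apply, toRat_mulVec, ratVec_eq_zero]

theorem IsPolynomialBasis.card_eq {κ : Type*} [Fintype κ]
    {N : Submodule (RatFunc ℂ) (κ → RatFunc ℂ)} {p q : ℕ} {Z : Matrix κ (Fin p) ℂ[X]}
    {W : Matrix κ (Fin q) ℂ[X]} (hZ : IsPolynomialBasis N Z) (hW : IsPolynomialBasis N W) :
    p = q := by
  have h1 := finrank_span_eq_card hZ.1
  have h2 := finrank_span_eq_card hW.1
  rw [hZ.2] at h1
  rw [hW.2, h1] at h2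
  simpa using h2

theorem toRat_col {κ : Type*} {p : ℕ} (Z : Matrix κ (Fin p) ℂ[X]) (j : Fin p) :
    (toRat Z).col j = ratVec (Z.col j) := rfl

/-- A polynomial matrix `D` that maps the polynomial null vectors of `M` bijectively onto those of
`M'` and lowers all degrees by the same number maps minimal bases to minimal bases. -/
theorem IsRightMinimalBasis.transfer {ι κ ι' κ' : Type*} [Fintype ι] [Fintype κ] [Fintype ι']
    [Fintype κ'] {M : Matrix ι κ ℂ[X]} {M' : Matrix ι' κ' ℂ[X]} {D : Matrix κ' κ ℂ[X]} {d : ℕ}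
    (hmap : ∀ x, M.mulVec x = 0 → M'.mulVec (D.mulVec x) = 0)
    (hinj : ∀ x, M.mulVec x = 0 → D.mulVec x = 0 → x = 0)
    (hsurj : ∀ v, M'.mulVec v = 0 → ∃ x, M.mulVec x = 0 ∧ D.mulVec x = v)
    (hdeg : ∀ x, M.mulVec x = 0 → x ≠ 0 → vecDegree x = vecDegree (D.mulVec x) + d)
    {p : ℕ} {Z : Matrix κ (Fin p) ℂ[X]} (hZ : IsRightMinimalBasis M Z) :
    IsRightMinimalBasis M' (D * Z) ∧ ∀ j, colDegree Z j = colDegree (D * Z) j + d := by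
  set N := rightNull (toRat M) with hN
  set N' := rightNull (toRat M') with hN'
  set f := (toRat D).mulVecLin with hf
  have hfr : ∀ x, f (ratVec x) = ratVec (D.mulVec x) := fun x => by
    rw [hf, Matrix.mulVecLin_apply, toRat_mulVec]
  have hfN : ∀ x ∈ N, f x ∈ N' := by
    intro x hx
    obtain ⟨q, hq, w, hw⟩ := exists_ratVec_smul x
    have h1 : ratVec w ∈ N := hw ▸ N.smul_mem q hx
    have h2 : f (ratVec w) ∈ N' := by
      rw [hfr]
      exact ratVec_mem_rightNull.2 (hmap w (ratVec_mem_rightNull.1 h1))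
    rw [← hw, map_smul] at h2
    exact (N'.smul_mem_iff hq).1 h2
  have hfinj : ∀ x ∈ N, f x = 0 → x = 0 := by
    intro x hx h0
    obtain ⟨q, hq, w, hw⟩ := exists_ratVec_smul x
    have h1 : ratVec w ∈ N := hw ▸ N.smul_mem q hx
    have h2 : f (ratVec w) = 0 := by rw [← hw, map_smul, h0, smul_zero]
    rw [hfr, ratVec_eq_zero] at h2
    have h3 := hinj w (ratVec_mem_rightNull.1 h1) h2
    rw [h3, ratVec_zero] at hw
    exact (smul_eq_zero.1 hw).resolve_left hq
  have hmapN : N.map f = N' := by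
    apply le_antisymm
    · rintro _ ⟨x, hx, rfl⟩
      exact hfN x hx
    · intro v hv
      obtain ⟨q, hq, w, hw⟩ := exists_ratVec_smul v
      have h1 : ratVec w ∈ N' := hw ▸ N'.smul_mem q hv
      obtain ⟨x, hx, hxw⟩ := hsurj w (ratVec_mem_rightNull.1 h1)
      have h2 : q • v ∈ N.map f := by
        rw [hw, ← hxw, ← hfr]
        exact ⟨_, ratVec_mem_rightNull.2 hx, rfl⟩
      exact ((N.map f).smul_mem_iff hq).1 h2
  have hcol : ∀ {q : ℕ} (W : Matrix κ (Fin q) ℂ[X]) (j : Fin q),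
      (D * W).col j = D.mulVec (W.col j) := fun W j => by
    funext i; rfl
  have hne : ∀ {q : ℕ} (W : Matrix κ (Fin q) ℂ[X]), IsPolynomialBasis N W → ∀ j,
      M.mulVec (W.col j) = 0 ∧ W.col j ≠ 0 := by
    intro q W hW j
    constructor
    · rw [← ratVec_mem_rightNull, ← hN, ← hW.2]
      exact Submodule.subset_span ⟨j, rfl⟩
    · intro h0
      apply hW.1.ne_zero j
      simp only [toRat_col, h0, ratVec_zero]
  have hdegW : ∀ {q : ℕ} (W : Matrix κ (Fin q) ℂ[X]), IsPolynomialBasis N W → ∀ j,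
      colDegree W j = colDegree (D * W) j + d := by
    intro q W hW j
    rw [colDegree_eq_vecDegree, colDegree_eq_vecDegree, hcol]
    exact hdeg _ (hne W hW j).1 (hne W hW j).2
  have hordW : ∀ {q : ℕ} (W : Matrix κ (Fin q) ℂ[X]), IsPolynomialBasis N W →
      order W = order (D * W) + q * d := by
    intro q W hW
    simp only [order, hdegW W hW, Finset.sum_add_distrib, Finset.sum_const, Finset.card_univ,
      Fintype.card_fin, smul_eq_mul]
  have hfcol : ∀ {q : ℕ} (W : Matrix κ (Fin q) ℂ[X]),
      (fun j => (toRat (D * W)).col j) = f ∘ fun j => (toRat W).col j := by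
    intro q W
    funext j
    simp only [Function.comp, toRat_col, hfr, hcol]
  refine ⟨⟨⟨?_, ?_⟩, ?_, ?_⟩, hdegW Z hZ.basis⟩
  · rw [hfcol]
    apply hZ.basis.1.map
    rw [hZ.basis.2, Submodule.disjoint_def]
    intro x hx hx0
    exact hfinj x hx hx0
  · rw [hfcol, Set.range_comp, ← Submodule.map_span, hZ.basis.2]
    exact hmapN
  · intro i j hij
    have := hZ.sorted hij
    rw [hdegW Z hZ.basis, hdegW Z hZ.basis] at this
    omega
  · intro q W hW
    change IsPolynomialBasis N' W at hW
    have hWn : ∀ j, M'.mulVec (W.col j) = 0 := by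
      intro j
      rw [← ratVec_mem_rightNull]
      change _ ∈ N'
      rw [← hW.2]
      exact Submodule.subset_span ⟨j, rfl⟩
    -- A competing basis `W` of the target is lifted columnwise to a basis `V` of the source with `D
    -- * V = W`, so minimality of `Z` applies to `V`.
    choose x hx hxW using fun j => hsurj (W.col j) (hWn j)
    set V : Matrix κ (Fin q) ℂ[X] := Matrix.of fun k j => x j k with hV
    have hVcol : ∀ j, V.col j = x j := fun j => rfl
    have hDV : D * V = W := by
      refine Matrix.ext fun i j => ?_
      have := congrFun (hxW j) i
      rw [← hVcol, ← hcol] at this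
      exact this
    have hle : Submodule.span (RatFunc ℂ) (Set.range fun j => (toRat V).col j) ≤ N := by
      rw [Submodule.span_le]
      rintro _ ⟨j, rfl⟩
      exact ratVec_mem_rightNull.2 (hx j)
    have hVb : IsPolynomialBasis N V := by
      constructor
      · apply LinearIndependent.of_comp f
        rw [← hfcol, hDV]
        exact hW.1
      · apply le_antisymm hle
        intro y hy
        have h1 : f y ∈ N' := hfN y hy
        rw [← hW.2, ← hDV, hfcol, Set.range_comp, ← Submodule.map_span] at h1
        obtain ⟨z, hz, hzy⟩ := h1
        have h2 : y - z = 0 := hfinj _ (N.sub_mem hy (hle hz)) (by rw [map_sub, hzy, sub_self])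
        rw [sub_eq_zero.1 h2]
        exact hz
    have h1 := hZ.order_le q V hVb
    -- Both bases have the same number of members, so the total degree shifts cancel.
    have hpq : p * d = q * d := by rw [hZ.basis.card_eq hVb]
    rw [hordW V hVb, hordW Z hZ.basis, hDV] at h1
    omega

end Transfer

/-! ### Constant matrices acting on polynomial vectors. -/

section Const

variable {ι κ μ : Type*}

theorem const_mul [Fintype κ] (M : Matrix ι κ ℂ) (N : Matrix κ μ ℂ) :
    const (M * N) = const M * const N := Matrix.map_mul

@[simp] theorem const_one [DecidableEq ι] : const (1 : Matrix ι ι ℂ) = 1 :=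
  Matrix.map_one _ Polynomial.C_0 Polynomial.C_1

@[simp] theorem const_zero : const (0 : Matrix ι κ ℂ) = 0 := Matrix.map_zero _ Polynomial.C_0

@[simp] theorem const_neg (M : Matrix ι κ ℂ) : const (-M) = -const M := by
  ext i j; simp [const]

theorem const_transpose (M : Matrix ι κ ℂ) : const M.transpose = (const M).transpose := rfl

theorem const_fromBlocks {ι' κ' : Type*} (A : Matrix ι κ ℂ) (B : Matrix ι κ' ℂ)
    (C : Matrix ι' κ ℂ) (D : Matrix ι' κ' ℂ) :
    const (Matrix.fromBlocks A B C D) = Matrix.fromBlocks (const A) (const B) (const C) (const D) :=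
  Matrix.fromBlocks_map _ _ _ _ _

theorem const_det [Fintype ι] [DecidableEq ι] (M : Matrix ι ι ℂ) :
    (const M).det = Polynomial.C M.det :=
  (RingHom.map_det Polynomial.C M).symm

theorem const_mulVec_injective [Fintype ι] [DecidableEq ι] {M : Matrix ι ι ℂ} (h : M.det ≠ 0)
    {x : ι → ℂ[X]} (hx : (const M).mulVec x = 0) : x = 0 := by
  refine Matrix.eq_zero_of_mulVec_eq_zero (M := const M) ?_ hx
  rw [const_det]
  exact fun h0 => h (Polynomial.C_eq_zero.1 h0)

/-- This lets nonsingularity of elementary matrices be read off from their blockwise action, without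
computing determinants. -/
theorem det_ne_zero_of_const_mulVec_injective [Fintype ι] [DecidableEq ι] {M : Matrix ι ι ℂ}
    (h : ∀ x : ι → ℂ[X], (const M).mulVec x = 0 → x = 0) : M.det ≠ 0 := by
  intro h0
  obtain ⟨v, hv, hv0⟩ := (Matrix.exists_mulVec_eq_zero_iff (M := const M)).2
    (by rw [const_det, h0, Polynomial.C_0])
  exact hv (h v hv0)

theorem natDegree_const_mulVec_le [Fintype κ] (M : Matrix ι κ ℂ) {x : κ → ℂ[X]} {d : ℕ}
    (hx : ∀ k, (x k).natDegree ≤ d) (i : ι) : ((const M).mulVec x i).natDegree ≤ d := by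
  refine Polynomial.natDegree_sum_le_of_forall_le _ _ fun k _ => ?_
  exact (Polynomial.natDegree_C_mul_le _ _).trans (hx k)

theorem vecDegree_const_mulVec [Fintype ι] [DecidableEq ι] {M : Matrix ι ι ℂ} (h : M.det ≠ 0)
    (x : ι → ℂ[X]) : vecDegree ((const M).mulVec x) = vecDegree x := by
  apply le_antisymm
  · exact vecDegree_le_iff.2 (natDegree_const_mulVec_le M (natDegree_le_vecDegree x))
  · have h1 : x = (const M⁻¹).mulVec ((const M).mulVec x) := by
      rw [Matrix.mulVec_mulVec, ← const_mul, Matrix.nonsing_inv_mul _ (isUnit_iff_ne_zero.2 h),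
        const_one, Matrix.one_mulVec]
    rw [vecDegree_le_iff]
    intro k
    have h2 := natDegree_const_mulVec_le M⁻¹ (natDegree_le_vecDegree ((const M).mulVec x)) k
    rwa [← h1] at h2

end Const

/-! ### Blocks of a vector and the blockwise action of elementary matrices. -/

section Registers

variable {m n r : ℕ}

/-- The block of `x` in block row `m - j` (counted from 1). -/
noncomputable def reg (x : (Fin m × Fin n) ⊕ Fin r → ℂ[X]) (j : ℕ) : Fin n → ℂ[X] :=
  fun k => if h : j < m then x (Sum.inl (⟨m - 1 - j, by omega⟩, k)) else 0

/-- The state part of `x`. -/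
def statePart (x : (Fin m × Fin n) ⊕ Fin r → ℂ[X]) : Fin r → ℂ[X] := fun k => x (Sum.inr k)

theorem reg_of_le (x : (Fin m × Fin n) ⊕ Fin r → ℂ[X]) {j : ℕ} (h : m ≤ j) : reg x j = 0 := by
  funext k; simp [reg, Nat.not_lt.2 h]

theorem reg_apply (x : (Fin m × Fin n) ⊕ Fin r → ℂ[X]) {j : ℕ} (h : j < m) (k : Fin n) :
    reg x j k = x (Sum.inl (⟨m - 1 - j, by omega⟩, k)) := by
  simp [reg, h]

theorem apply_inl (x : (Fin m × Fin n) ⊕ Fin r → ℂ[X]) (a : Fin m) (k : Fin n) :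
    x (Sum.inl (a, k)) = reg x (m - 1 - a) k := by
  rw [reg_apply x (by omega)]
  congr 3
  ext
  simp; omega

theorem ext_reg {x y : (Fin m × Fin n) ⊕ Fin r → ℂ[X]} (h : ∀ j < m, reg x j = reg y j)
    (hs : statePart x = statePart y) : x = y := by
  funext i
  rcases i with ⟨a, k⟩ | k
  · rw [apply_inl x, apply_inl y, h _ (by omega)]
  · exact congrFun hs k

@[simp] theorem reg_zero (j : ℕ) : reg (0 : (Fin m × Fin n) ⊕ Fin r → ℂ[X]) j = 0 := by
  funext k; simp [reg]

@[simp] theorem statePart_zero : statePart (0 : (Fin m × Fin n) ⊕ Fin r → ℂ[X]) = 0 := rfl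

theorem reg_smul (c : ℂ[X]) (x : (Fin m × Fin n) ⊕ Fin r → ℂ[X]) (j : ℕ) :
    reg (c • x) j = c • reg x j := by
  funext k; simp only [reg, Pi.smul_apply]; split_ifs <;> simp

/-- Assemble a vector from its blocks and its state part. -/
def ofReg (y : ℕ → Fin n → ℂ[X]) (w : Fin r → ℂ[X]) : (Fin m × Fin n) ⊕ Fin r → ℂ[X] :=
  Sum.elim (fun a => y (m - 1 - a.1) a.2) w

theorem reg_ofReg (y : ℕ → Fin n → ℂ[X]) (w : Fin r → ℂ[X]) {j : ℕ} (h : j < m) :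
    reg (ofReg (m := m) y w) j = y j := by
  funext k
  rw [reg_apply _ h]
  simp only [ofReg, Sum.elim_inl]
  congr 1
  omega

theorem statePart_ofReg (y : ℕ → Fin n → ℂ[X]) (w : Fin r → ℂ[X]) :
    statePart (ofReg (m := m) y w) = w := rfl

theorem comp_inr_eq_statePart (x : (Fin m × Fin n) ⊕ Fin r → ℂ[X]) :
    x ∘ Sum.inr = statePart x := rfl

theorem comp_mulVec_inl (Bl : Matrix (Fin m) (Fin m) (Matrix (Fin n) (Fin n) ℂ))
    (x : (Fin m × Fin n) ⊕ Fin r → ℂ[X]) (a : Fin m) (k : Fin n) :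
    (const (Matrix.comp (Fin m) (Fin m) (Fin n) (Fin n) ℂ Bl)).mulVec (x ∘ Sum.inl) (a, k) =
      ∑ b, (const (Bl a b)).mulVec (reg x (m - 1 - b)) k := by
  simp only [Matrix.mulVec, dotProduct, Fintype.sum_prod_type, const, Matrix.map_apply,
    Matrix.comp_apply, Function.comp, apply_inl]

theorem comp_row_single {Bl : Matrix (Fin m) (Fin m) (Matrix (Fin n) (Fin n) ℂ)} {a b₁ : Fin m}
    {X₁ : Matrix (Fin n) (Fin n) ℂ} (h : ∀ b, Bl a b = if b = b₁ then X₁ else 0)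
    (x : (Fin m × Fin n) ⊕ Fin r → ℂ[X]) (k : Fin n) :
    ∑ b, (const (Bl a b)).mulVec (reg x (m - 1 - b)) k =
      (const X₁).mulVec (reg x (m - 1 - b₁)) k := by
  rw [Finset.sum_eq_single b₁]
  · simp [h]
  · intro b _ hb
    simp [h, hb]
  · simp

theorem comp_row_pair {Bl : Matrix (Fin m) (Fin m) (Matrix (Fin n) (Fin n) ℂ)} {a b₁ b₂ : Fin m}
    {X₁ X₂ : Matrix (Fin n) (Fin n) ℂ} (h12 : b₁ ≠ b₂)
    (h : ∀ b, Bl a b = if b = b₁ then X₁ else if b = b₂ then X₂ else 0)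
    (x : (Fin m × Fin n) ⊕ Fin r → ℂ[X]) (k : Fin n) :
    ∑ b, (const (Bl a b)).mulVec (reg x (m - 1 - b)) k =
      (const X₁).mulVec (reg x (m - 1 - b₁)) k + (const X₂).mulVec (reg x (m - 1 - b₂)) k := by
  rw [Finset.sum_eq_add b₁ b₂ h12]
  · simp [h, h12.symm]
  · intro b _ hb
    simp [h, hb.1, hb.2]
  · simp
  · simp

variable {i : ℤ} {Y : Matrix (Fin n) (Fin n) ℂ}

/-- The two inequalities also serve `i = 0` and `i = -m`, where one of them holds automatically. -/
theorem elemBlocks_row_other {a : Fin m} (h1 : (a : ℕ) + 1 + i.natAbs ≠ m)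
    (h2 : (a : ℕ) + i.natAbs ≠ m) (b : Fin m) :
    elemBlocks m i Y a b = if b = a then 1 else 0 := by
  unfold elemBlocks
  split_ifs with hi hi' <;> simp_all [eq_comm]

theorem elemBlocks_zero_row {a : Fin m} (h : (a : ℕ) + 1 = m) (b : Fin m) :
    elemBlocks m 0 Y a b = if b = a then Y else 0 := by
  simp [elemBlocks, Matrix.diagonal_apply, eq_comm, h]

theorem elemBlocks_neg_row {a : Fin m} (h : (a : ℕ) = 0) (b : Fin m) :
    elemBlocks m (-m) Y a b = if b = a then Y else 0 := by
  have hm : m ≠ 0 := by omega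
  simp [elemBlocks, Matrix.diagonal_apply, eq_comm, h, hm]

theorem elemBlocks_row_left {a a' : Fin m} (h1 : 0 < i.natAbs) (h2 : i.natAbs < m)
    (h : (a : ℕ) + 1 + i.natAbs = m) (h' : (a' : ℕ) = a + 1) (b : Fin m) :
    elemBlocks m i Y a b = if b = a then (if 0 < i then Y else 0) else if b = a' then 1 else 0 := by
  have hi : i ≠ 0 := by omega
  have hi' : i ≠ -(m : ℤ) := by omega
  simp only [elemBlocks, hi, hi', if_false, Matrix.of_apply, Fin.ext_iff]
  grind

theorem elemBlocks_row_right {a a' : Fin m} (h1 : 0 < i.natAbs) (h2 : i.natAbs < m)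
    (h : (a : ℕ) + i.natAbs = m) (h' : (a : ℕ) = a' + 1) (b : Fin m) :
    elemBlocks m i Y a b = if b = a then (if 0 < i then 0 else Y) else if b = a' then 1 else 0 := by
  have hi : i ≠ 0 := by omega
  have hi' : i ≠ -(m : ℤ) := by omega
  simp only [elemBlocks, hi, hi', if_false, Matrix.of_apply, Fin.ext_iff]
  grind

theorem reg_fromBlocks_mulVec {Bl : Matrix (Fin m) (Fin m) (Matrix (Fin n) (Fin n) ℂ)}
    {B : Matrix (Fin m × Fin n) (Fin r) ℂ} {C : Matrix (Fin r) (Fin m × Fin n) ℂ}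
    {D : Matrix (Fin r) (Fin r) ℂ} (x : (Fin m × Fin n) ⊕ Fin r → ℂ[X]) {j : ℕ} (h : j < m)
    (k : Fin n) :
    reg ((const (Matrix.fromBlocks (Matrix.comp (Fin m) (Fin m) (Fin n) (Fin n) ℂ Bl) B C D)).mulVec
      x) j k =
      ∑ b, (const (Bl ⟨m - 1 - j, by omega⟩ b)).mulVec (reg x (m - 1 - b)) k +
        (const B).mulVec (statePart x) (⟨m - 1 - j, by omega⟩, k) := by
  rw [reg_apply _ h, const_fromBlocks, Matrix.fromBlocks_mulVec, Sum.elim_inl, Pi.add_apply,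
    comp_mulVec_inl, comp_inr_eq_statePart]

theorem statePart_fromBlocks_mulVec {A : Matrix (Fin m × Fin n) (Fin m × Fin n) ℂ}
    {B : Matrix (Fin m × Fin n) (Fin r) ℂ} {C : Matrix (Fin r) (Fin m × Fin n) ℂ}
    {D : Matrix (Fin r) (Fin r) ℂ} (x : (Fin m × Fin n) ⊕ Fin r → ℂ[X]) :
    statePart ((const (Matrix.fromBlocks A B C D)).mulVec x) =
      (const C).mulVec (x ∘ Sum.inl) + (const D).mulVec (statePart x) := by
  funext k
  simp [statePart, const_fromBlocks, Matrix.fromBlocks_mulVec, comp_inr_eq_statePart]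

theorem reg_bigElem (x : (Fin m × Fin n) ⊕ Fin r → ℂ[X]) {j : ℕ} (h : j < m) (k : Fin n) :
    reg ((const (bigElem m r i Y)).mulVec x) j k =
      ∑ b, (const (elemBlocks m i Y ⟨m - 1 - j, by omega⟩ b)).mulVec (reg x (m - 1 - b)) k := by
  rw [bigElem, elem, reg_fromBlocks_mulVec x h]
  simp

theorem statePart_bigElem (x : (Fin m × Fin n) ⊕ Fin r → ℂ[X]) :
    statePart ((const (bigElem m r i Y)).mulVec x) = statePart x := by
  rw [bigElem, statePart_fromBlocks_mulVec]
  simp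

theorem reg_bigElem_other (x : (Fin m × Fin n) ⊕ Fin r → ℂ[X]) {j : ℕ} (h1 : j ≠ i.natAbs)
    (h2 : j + 1 ≠ i.natAbs) : reg ((const (bigElem m r i Y)).mulVec x) j = reg x j := by
  rcases lt_or_ge j m with h | h
  · funext k
    rw [reg_bigElem x h, comp_row_single (elemBlocks_row_other _ _), const_one, Matrix.one_mulVec]
    · congr 1
      simp; omega
    · simp; omega
    · simp; omega
  · rw [reg_of_le _ h, reg_of_le _ h]

theorem reg_bigElem_zero (x : (Fin m × Fin n) ⊕ Fin r → ℂ[X]) (h : 0 < m) :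
    reg ((const (bigElem m r 0 Y)).mulVec x) 0 = (const Y).mulVec (reg x 0) := by
  funext k
  rw [reg_bigElem x h, comp_row_single (elemBlocks_zero_row (by simp; omega))]
  congr 2
  simp

theorem reg_bigElem_neg_last (x : (Fin m × Fin n) ⊕ Fin r → ℂ[X]) (h : 0 < m) :
    reg ((const (bigElem m r (-m) Y)).mulVec x) (m - 1) = (const Y).mulVec (reg x (m - 1)) := by
  funext k
  rw [reg_bigElem x (by omega), comp_row_single (elemBlocks_neg_row (by simp))]
  congr 2
  simp

theorem reg_bigElem_natAbs (x : (Fin m × Fin n) ⊕ Fin r → ℂ[X]) (h1 : 0 < i.natAbs)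
    (h2 : i.natAbs < m) :
    reg ((const (bigElem m r i Y)).mulVec x) i.natAbs =
      (const (if 0 < i then Y else 0)).mulVec (reg x i.natAbs) + reg x (i.natAbs - 1) := by
  funext k
  rw [reg_bigElem x h2,
    comp_row_pair (b₂ := ⟨m - i.natAbs, by omega⟩) _
      (elemBlocks_row_left h1 h2 (by simp; omega) (by simp; omega)), const_one, Matrix.one_mulVec]
  · simp only [Pi.add_apply]
    rw [show m - 1 - (m - 1 - i.natAbs) = i.natAbs by omega,
      show m - 1 - (m - i.natAbs) = i.natAbs - 1 by omega]
  · simp [Fin.ext_iff]; omega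

theorem reg_bigElem_natAbs_sub_one (x : (Fin m × Fin n) ⊕ Fin r → ℂ[X]) (h1 : 0 < i.natAbs)
    (h2 : i.natAbs < m) :
    reg ((const (bigElem m r i Y)).mulVec x) (i.natAbs - 1) =
      (const (if 0 < i then 0 else Y)).mulVec (reg x (i.natAbs - 1)) + reg x i.natAbs := by
  funext k
  rw [reg_bigElem x (by omega),
    comp_row_pair (b₂ := ⟨m - 1 - i.natAbs, by omega⟩) _
      (elemBlocks_row_right h1 h2 (by simp; omega) (by simp; omega)), const_one, Matrix.one_mulVec]
  · simp only [Pi.add_apply]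
    rw [show m - 1 - (m - 1 - (i.natAbs - 1)) = i.natAbs - 1 by omega,
      show m - 1 - (m - 1 - i.natAbs) = i.natAbs by omega]
  · simp [Fin.ext_iff]; omega

theorem det_bigElem_ne_zero (h1 : 0 < i.natAbs) (h2 : i.natAbs < m) :
    (bigElem m r i Y).det ≠ 0 := by
  apply det_ne_zero_of_const_mulVec_injective
  intro x hx
  have e1 := reg_bigElem_natAbs (Y := Y) x h1 h2
  have e2 := reg_bigElem_natAbs_sub_one (Y := Y) x h1 h2
  have e3 := statePart_bigElem (i := i) (Y := Y) x
  rw [hx, reg_zero] at e1 e2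
  rw [hx, statePart_zero] at e3
  -- The sign of `i` decides which of the two rows is a pure copy; that row kills one block, and the
  -- other row then kills the second.
  have e4 : reg x i.natAbs = 0 ∧ reg x (i.natAbs - 1) = 0 := by
    split_ifs at e1 e2
    · simp only [const_zero, Matrix.zero_mulVec, zero_add] at e2
      rw [← e2] at e1
      simp only [Matrix.mulVec_zero, zero_add] at e1
      exact ⟨e2.symm, e1.symm⟩
    · simp only [const_zero, Matrix.zero_mulVec, zero_add] at e1
      rw [← e1] at e2
      simp only [Matrix.mulVec_zero, zero_add] at e2
      exact ⟨e2.symm, e1.symm⟩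
  refine ext_reg (fun j _ => ?_) e3.symm
  rw [reg_zero]
  by_cases hj : j = i.natAbs
  · rw [hj, e4.1]
  by_cases hj' : j + 1 = i.natAbs
  · rw [show j = i.natAbs - 1 by omega, e4.2]
  · rw [← reg_bigElem_other (i := i) (Y := Y) x hj hj', hx, reg_zero]

theorem det_bigElem_zero_ne_zero (h : 0 < m) (hY : Y.det ≠ 0) : (bigElem m r 0 Y).det ≠ 0 := by
  apply det_ne_zero_of_const_mulVec_injective
  intro x hx
  have e1 := reg_bigElem_zero (Y := Y) x h
  have e3 := statePart_bigElem (i := 0) (Y := Y) x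
  rw [hx, reg_zero] at e1
  rw [hx, statePart_zero] at e3
  refine ext_reg (fun j _ => ?_) e3.symm
  rw [reg_zero]
  by_cases hj : j = 0
  · rw [hj]
    exact const_mulVec_injective hY e1.symm
  · rw [← reg_bigElem_other (i := 0) (Y := Y) x (by simpa) (by simp), hx, reg_zero]

theorem det_bigElem_neg_last_ne_zero (h : 0 < m) (hY : Y.det ≠ 0) :
    (bigElem m r (-m) Y).det ≠ 0 := by
  apply det_ne_zero_of_const_mulVec_injective
  intro x hx
  have e1 := reg_bigElem_neg_last (Y := Y) x h
  have e3 := statePart_bigElem (i := -m) (Y := Y) x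
  rw [hx, reg_zero] at e1
  rw [hx, statePart_zero] at e3
  refine ext_reg (fun j hj' => ?_) e3.symm
  rw [reg_zero]
  by_cases hj : j = m - 1
  · rw [hj]
    exact const_mulVec_injective hY e1.symm
  · rw [← reg_bigElem_other (i := -m) (Y := Y) x (by simp; omega) (by simp; omega), hx, reg_zero]

/-- Factors with `0 < |i| < m` are invertible for every assigned matrix; only the indices `0` and
`-m` need the assignment to be nonsingular. -/
theorem det_bigElemProd_ne_zero (hm : 0 < m) {t : List ℤ} {X : List (Matrix (Fin n) (Fin n) ℂ)}
    (ht : ∀ i ∈ t, i.natAbs < m ∨ i = -m) (hX : IsNonsingularAssignment m t X) :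
    (bigElemProd m r t X).det ≠ 0 := by
  rw [bigElemProd]
  induction t generalizing X with
  | nil => simp
  | cons i t ih =>
    rcases X with _ | ⟨Y, X⟩
    · simp
    · rw [List.zipWith_cons_cons, List.prod_cons, Matrix.det_mul]
      refine mul_ne_zero ?_ (ih (fun j hj => ht j (by simp [hj])) ⟨by simpa using hX.1, ?_⟩)
      · have hY := hX.2 (i, Y) (by simp)
        rcases ht i (by simp) with h1 | h1
        · by_cases h0 : i = 0
          · subst h0
            exact det_bigElem_zero_ne_zero hm (hY (Or.inl rfl))
          · exact det_bigElem_ne_zero (by omega) h1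
        · subst h1
          exact det_bigElem_neg_last_ne_zero hm (hY (Or.inr rfl))
      · exact fun q hq => hX.2 q (by simp [hq])

end Registers

/-! ### Blockwise action of the Fiedler matrices of the system matrix. -/

namespace Realization

variable {m n r : ℕ} (R : Realization m n r)

theorem fiedlerS_pos {i : ℕ} (h : 0 < i) :
    R.fiedlerS i = bigElem m r i (-R.coeff i) := by
  have h2 : (i : ℤ) ≠ -(m : ℤ) := by omega
  simp [fiedlerS, fiedlerP, bigElem, h2, h, h.ne']

theorem fiedlerS_neg {i : ℕ} (h : 0 < i) (h' : i < m) :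
    R.fiedlerS (-i) = (R.fiedlerS i)⁻¹ := by
  have h2 : (i : ℤ) ≠ -(m : ℤ) := by omega
  have h3 : i ≠ m := by omega
  simp [fiedlerS, h2, h, h3, h.ne', (Int.natCast_nonneg i).not_gt]

theorem det_fiedlerS_pos {i : ℕ} (h : 0 < i) (h' : i < m) : (R.fiedlerS i).det ≠ 0 := by
  rw [R.fiedlerS_pos h]
  exact det_bigElem_ne_zero (by simpa) (by simpa)

variable (x : (Fin m × Fin n) ⊕ Fin r → ℂ[X])

theorem reg_fiedlerS_other {i j : ℕ} (h1 : j ≠ i) (h2 : j + 1 ≠ i) :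
    reg ((const (R.fiedlerS i)).mulVec x) j = reg x j := by
  rcases Nat.eq_zero_or_pos i with rfl | h
  · rcases lt_or_ge j m with h | h
    · funext k
      simp only [fiedlerS, fiedlerP, elem, Nat.cast_zero, if_true, le_rfl]
      rw [reg_fromBlocks_mulVec x h,
        comp_row_single (elemBlocks_row_other _ _), const_one, Matrix.one_mulVec]
      · have h3 : m - 1 - j + 1 ≠ m := by omega
        have h4 : m - 1 - (m - 1 - j) = j := by omega
        have h5 : ((m - 1 - j : ℕ) : ℤ) + 1 ≠ m := by omega
        simp [h4, Matrix.mulVec, dotProduct, const, blockCol, h5]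
      · simp; omega
      · simp; omega
    · rw [reg_of_le _ h, reg_of_le _ h]
  · rw [R.fiedlerS_pos h, reg_bigElem_other x (by simpa) (by simpa)]

theorem reg_fiedlerS_self {i : ℕ} (h : 0 < i) (h' : i < m) :
    reg ((const (R.fiedlerS i)).mulVec x) i =
      reg x (i - 1) - (const (R.coeff i)).mulVec (reg x i) := by
  have := reg_bigElem_natAbs (r := r) (i := i) (Y := -R.coeff i) x (by simpa) (by simpa)
  rw [R.fiedlerS_pos h]
  simp only [Int.natAbs_natCast, Nat.cast_pos, h, if_true] at this
  rw [this, const_neg, Matrix.neg_mulVec, neg_add_eq_sub]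

theorem reg_fiedlerS_pred {i : ℕ} (h : 0 < i) (h' : i < m) :
    reg ((const (R.fiedlerS i)).mulVec x) (i - 1) = reg x i := by
  have := reg_bigElem_natAbs_sub_one (r := r) (i := i) (Y := -R.coeff i) x (by simpa) (by simpa)
  rw [R.fiedlerS_pos h]
  simp only [Int.natAbs_natCast, Nat.cast_pos, h, if_true] at this
  rw [this, const_zero, Matrix.zero_mulVec, zero_add]

theorem statePart_fiedlerS_pos {i : ℕ} (h : 0 < i) :
    statePart ((const (R.fiedlerS i)).mulVec x) = statePart x := by
  rw [R.fiedlerS_pos h, statePart_bigElem]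

theorem reg_fiedlerS_zero (h : 0 < m) :
    reg ((const (R.fiedlerS 0)).mulVec x) 0 =
      -(const (R.coeff 0)).mulVec (reg x 0) - (const R.C).mulVec (statePart x) := by
  funext k
  simp only [fiedlerS, fiedlerP, elem, if_true, le_rfl]
  rw [reg_fromBlocks_mulVec x h,
    comp_row_single (elemBlocks_zero_row (by simp; omega))]
  have h5 : ((m - 1 : ℕ) : ℤ) + 1 = m := by omega
  simp [Matrix.mulVec, dotProduct, const, blockCol, h5, sub_eq_add_neg]

theorem statePart_fiedlerS_zero (h : 0 < m) :
    statePart ((const (R.fiedlerS 0)).mulVec x) =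
      -(const R.B).mulVec (reg x 0) - (const R.A).mulVec (statePart x) := by
  simp only [fiedlerS, if_true]
  rw [statePart_fromBlocks_mulVec, const_neg, const_neg, Matrix.neg_mulVec, Matrix.neg_mulVec,
    ← sub_eq_add_neg]
  congr 2
  funext k
  simp only [Matrix.mulVec, dotProduct, Fintype.sum_prod_type]
  rw [Finset.sum_eq_single ⟨m - 1, by omega⟩]
  · have h5 : ((m - 1 : ℕ) : ℤ) + 1 = m := by omega
    simp [const, blockRow, apply_inl, h5]
  · intro b _ hb
    have h5 : (b : ℤ) + 1 ≠ m := by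
      intro h6
      apply hb
      ext
      simp; omega
    simp [const, blockRow, h5]
  · simp

theorem fiedlerS_neg_last (h : 0 < m) : R.fiedlerS (-m) =
    Matrix.fromBlocks (elem m (-m) (R.coeff m)) 0 0 (-R.E) := by
  have h1 : m ≠ 0 := by omega
  simp [fiedlerS, fiedlerP, h1]

theorem reg_fiedlerS_neg_other {j : ℕ} (h : j + 1 < m) :
    reg ((const (R.fiedlerS (-m))).mulVec x) j = reg x j := by
  funext k
  rw [R.fiedlerS_neg_last (by omega), elem, reg_fromBlocks_mulVec x (by omega),
    comp_row_single (elemBlocks_row_other _ _), const_one, Matrix.one_mulVec]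
  · have h4 : m - 1 - (m - 1 - j) = j := by omega
    simp [h4]
  · simp
  · simp; omega

theorem reg_fiedlerS_neg_last (h : 0 < m) :
    reg ((const (R.fiedlerS (-m))).mulVec x) (m - 1) =
      (const (R.coeff m)).mulVec (reg x (m - 1)) := by
  funext k
  rw [R.fiedlerS_neg_last h, elem, reg_fromBlocks_mulVec x (by omega),
    comp_row_single (elemBlocks_neg_row (by simp))]
  simp

theorem statePart_fiedlerS_neg_last (h : 0 < m) :
    statePart ((const (R.fiedlerS (-m))).mulVec x) = -(const R.E).mulVec (statePart x) := by
  rw [R.fiedlerS_neg_last h, statePart_fromBlocks_mulVec]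
  simp [Matrix.neg_mulVec]

end Realization

/-! ### Greedy runs, the successor infix property, and relative order in tuples. -/

section Lists

/-- The end of the run `p + 1, p + 2, …` that is obtained by reading `t` from left to right and
taking every next element of the run where it first occurs. -/
def greedyRun : ℕ → List ℤ → ℕ
  | p, [] => p
  | p, i :: t => if i = p + 1 then greedyRun (p + 1) t else greedyRun p t

theorem le_greedyRun (p : ℕ) (t : List ℤ) : p ≤ greedyRun p t := by
  induction t generalizing p with
  | nil => exact le_rfl
  | cons i t ih =>
    rw [greedyRun]
    split_ifs
    · exact (Nat.le_succ p).trans (ih _)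
    · exact ih p

theorem greedyRun_le {p h : ℕ} {t : List ℤ} (hp : p ≤ h) (ht : ∀ i ∈ t, i ≤ (h : ℤ)) :
    greedyRun p t ≤ h := by
  induction t generalizing p with
  | nil => exact hp
  | cons i t ih =>
    rw [greedyRun]
    have hi := ht i (by simp)
    split_ifs
    · exact ih (by omega) fun j hj => ht j (by simp [hj])
    · exact ih hp fun j hj => ht j (by simp [hj])

/-- Greedy matching is optimal: taking the next needed index at its first occurrence leaves the
longest possible remainder. -/
theorem range'_sublist_iff (p k : ℕ) (t : List ℤ) :
    ((List.range' (p + 1) k).map ((↑) : ℕ → ℤ)).Sublist t ↔ p + k ≤ greedyRun p t := by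
  induction t generalizing p k with
  | nil => cases k <;> simp [greedyRun, List.range'_succ]
  | cons i t ih =>
    cases k with
    | zero => simpa using le_greedyRun p (i :: t)
    | succ k =>
      rw [List.range'_succ, List.map_cons, greedyRun]
      split_ifs with hi
      · subst hi
        rw [Nat.cast_succ, List.cons_sublist_cons, ih]
        omega
      · rw [← ih p (k + 1), List.range'_succ, List.map_cons]
        constructor
        · intro hs
          rcases List.sublist_cons_iff.1 hs with hs | ⟨u, hu, _⟩
          · exact hs
          · exact absurd (by simpa using (List.cons.inj hu).1.symm) hi
        · exact fun hs => hs.cons i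

theorem cons_sublist_append_cons_iff {a : ℤ} {l : List ℤ} (h : a ∉ l) (u s : List ℤ) :
    (a :: u).Sublist (l ++ a :: s) ↔ u.Sublist s := by
  induction l with
  | nil => simp
  | cons b l ih =>
    rw [List.mem_cons, not_or] at h
    rw [List.cons_append, ← ih h.2]
    constructor
    · intro hs
      rcases List.sublist_cons_iff.1 hs with hs | ⟨v, hv, _⟩
      · exact hs
      · exact absurd (List.cons.inj hv).1 h.1
    · exact fun hs => hs.cons b

theorem flatMap_singleton_eq_map {α β : Type*} (f : α → β) (l : List α) :
    l.flatMap (fun a => [f a]) = l.map f := by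
  induction l with
  | nil => rfl
  | cons a l ih => simp [ih]

theorem run_zero (p : ℕ) : run 0 p = 0 :: (List.range' 1 p).map ((↑) : ℕ → ℤ) := by
  rw [run, List.range_eq_range', List.range'_succ]
  simp [flatMap_singleton_eq_map]

/-- A run from 0 may as well start at the first 0, which the hypothesis locates. Later zeros in `s`
are allowed, as `σ₂` may contain some. -/
theorem consecutionsAt_zero {l s : List ℤ} (h : (0 : ℤ) ∉ l) :
    consecutionsAt 0 (l ++ 0 :: s) = (greedyRun 0 s : ℤ) := by
  have key : ∀ p, (run 0 p).Sublist (l ++ 0 :: s) ↔ p ≤ greedyRun 0 s := by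
    intro p
    rw [run_zero, cons_sublist_append_cons_iff h]
    simpa using range'_sublist_iff 0 p s
  rw [consecutionsAt, if_pos (by simp)]
  congr 1
  rw [Nat.findGreatest_eq_iff]
  refine ⟨?_, fun _ => (key _).2 le_rfl, fun k hk _ => by rw [key]; omega⟩
  have := ((key _).2 le_rfl).length_le
  rw [run_zero] at this
  simpa using (Nat.le_succ _).trans this

theorem SIP.mem_between {l₁ l₂ l₃ : List ℤ} {a : ℤ} (h : SIP (l₁ ++ a :: l₂ ++ a :: l₃)) :
    a + 1 ∈ l₂ := by
  set t := l₁ ++ a :: l₂ ++ a :: l₃ with ht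
  have hlen : t.length = l₁.length + (l₂.length + 1) + (l₃.length + 1) := by
    simp [ht]; omega
  have e : ∀ k (hk : k < l₂.length), t[l₁.length + 1 + k]'(by omega) = l₂[k] := by
    intro k hk
    simp only [ht, List.append_assoc]
    rw [List.getElem_append_right (by omega)]
    simp only [List.cons_append]
    rw [List.getElem_cons, dif_neg (by omega), List.getElem_append_left (by omega)]
    congr 1
    omega
  have e1 : t[l₁.length]'(by omega) = a := by
    simp [ht]
  have e2 : t[l₁.length + 1 + l₂.length]'(by omega) = a := by
    simp only [ht]
    rw [List.getElem_append_right (by simp; omega)]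
    simp [List.getElem_cons]
    omega
  obtain ⟨c, h1, h2, h3⟩ := h ⟨l₁.length, by omega⟩ ⟨l₁.length + 1 + l₂.length, by omega⟩
    (by rw [Fin.lt_def]; simp only; omega) (by simp only [List.get_eq_getElem, e1, e2])
  rw [Fin.lt_def] at h1 h2
  simp only at h1 h2
  simp only [List.get_eq_getElem, e1] at h3
  have e3 := e (c - (l₁.length + 1)) (by omega)
  have e4 : l₁.length + 1 + (c.1 - (l₁.length + 1)) = c := by omega
  simp only [e4, h3] at e3
  rw [e3]
  exact List.getElem_mem _

/-- Between any two occurrences of an index in `t` there is an occurrence of its successor. -/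
def SuccBetween (t : List ℤ) : Prop :=
  ∀ l₁ l₂ l₃ a, t = l₁ ++ a :: l₂ ++ a :: l₃ → a + 1 ∈ l₂

theorem SIP.succBetween {t : List ℤ} (h : SIP t) : SuccBetween t := by
  rintro l₁ l₂ l₃ a rfl
  exact h.mem_between

theorem SuccBetween.of_append {l t : List ℤ} (h : SuccBetween (l ++ t)) : SuccBetween t := by
  rintro l₁ l₂ l₃ a rfl
  exact h (l ++ l₁) l₂ l₃ a (by simp)

/-- Adjacent equal entries leave no room for the successor. -/
theorem SuccBetween.ne {p i : ℤ} {t : List ℤ} (h : SuccBetween (p :: i :: t)) : i ≠ p := by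
  rintro rfl
  simpa using h [] [] t i rfl

/-- A pair beginning at the head needs a `p + 1` in between, which the erased entry is not; pairs
inside `t` are untouched. -/
theorem SuccBetween.erase_second {p i : ℤ} {t : List ℤ} (h : SuccBetween (p :: i :: t))
    (hi : i ≠ p + 1) : SuccBetween (p :: t) := by
  intro l₁ l₂ l₃ a hl
  rcases l₁ with _ | ⟨b, l₁⟩
  · simp only [List.nil_append, List.cons_append, List.cons.injEq] at hl
    obtain ⟨rfl, rfl⟩ := hl
    have := h [] (i :: l₂) l₃ p rfl
    rcases List.mem_cons.1 this with h1 | h1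
    · exact absurd h1.symm hi
    · exact h1
  · simp only [List.cons_append, List.cons.injEq] at hl
    obtain ⟨rfl, rfl⟩ := hl
    exact h (p :: i :: l₁) l₂ l₃ a (by simp)

theorem SIP.reverse {t : List ℤ} (h : SIP t) : SIP t.reverse := by
  intro a b hab heq
  have hl : t.reverse.length = t.length := List.length_reverse
  have ha := a.2
  have hb := b.2
  rw [Fin.lt_def] at hab
  simp only [List.get_eq_getElem, List.getElem_reverse] at heq
  obtain ⟨c, h1, h2, h3⟩ := h ⟨t.length - 1 - b, by omega⟩ ⟨t.length - 1 - a, by omega⟩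
    (by rw [Fin.lt_def]; simp only; omega) heq.symm
  rw [Fin.lt_def] at h1 h2
  simp only at h1 h2
  refine ⟨⟨t.length - 1 - c, by omega⟩, ?_, ?_, ?_⟩
  · rw [Fin.lt_def]; simp only; omega
  · rw [Fin.lt_def]; simp only; omega
  · simp only [List.get_eq_getElem, List.getElem_reverse] at h3 ⊢
    rw [heq, ← h3]
    congr 1
    omega

theorem exists_split_pair {α : List ℤ} {a b : ℤ} (ha : a ∈ α) (hb : b ∈ α) (hab : a ≠ b) :
    (∃ l s₁ s₂, α = l ++ a :: (s₁ ++ b :: s₂)) ∨ ∃ l s₁ s₂, α = l ++ b :: (s₁ ++ a :: s₂) := by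
  obtain ⟨l, s, rfl⟩ := List.append_of_mem ha
  rw [List.mem_append, List.mem_cons] at hb
  rcases hb with hb | hb | hb
  · obtain ⟨l₁, l₂, rfl⟩ := List.append_of_mem hb
    exact Or.inr ⟨l₁, l₂, s, by simp⟩
  · exact absurd hb.symm hab
  · obtain ⟨l₁, l₂, rfl⟩ := List.append_of_mem hb
    exact Or.inl ⟨l, l₁, l₂, rfl⟩

theorem not_pair_sublist {a b : ℤ} {l s₁ s₂ : List ℤ}
    (hα : (l ++ a :: (s₁ ++ b :: s₂)).Nodup) :
    ¬ [b, a].Sublist (l ++ a :: (s₁ ++ b :: s₂)) := by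
  intro h
  have h1 : l ++ a :: (s₁ ++ b :: s₂) = (l ++ a :: s₁) ++ b :: s₂ := by simp
  rw [h1] at h hα
  have hb : b ∉ l ++ a :: s₁ := fun hb =>
    List.disjoint_of_nodup_append hα hb (by simp)
  rw [cons_sublist_append_cons_iff hb, List.singleton_sublist] at h
  exact List.disjoint_of_nodup_append hα (by simp) (List.mem_cons_of_mem _ h)

theorem pair_sublist (a b : ℤ) (l s₁ s₂ : List ℤ) :
    [a, b].Sublist (l ++ a :: (s₁ ++ b :: s₂)) :=
  (List.Sublist.cons_cons a (List.singleton_sublist.2 (by simp))).trans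
    (List.sublist_append_right _ _)

end Lists

/-! ### Tracing a block through a product of factors with the SIP. -/

section Gates

variable {m n r : ℕ}

/-- A matrix that acts on the blocks of a vector like an elementary matrix of index `i ≥ 0`, except
that nothing is said about block `i` of the result. -/
structure IsGate (i : ℤ) (M : Matrix ((Fin m × Fin n) ⊕ Fin r) ((Fin m × Fin n) ⊕ Fin r) ℂ) :
    Prop where
  other : ∀ x (j : ℕ), (j : ℤ) ≠ i → (j : ℤ) + 1 ≠ i → reg ((const M).mulVec x) j = reg x j
  pred : ∀ x (j : ℕ), (j : ℤ) + 1 = i → reg ((const M).mulVec x) j = reg x (j + 1)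

theorem isGate_bigElem {i : ℤ} (h : 0 ≤ i) (h' : i < m) (Y : Matrix (Fin n) (Fin n) ℂ) :
    IsGate i (bigElem m r i Y) := by
  constructor
  · intro x j h1 h2
    exact reg_bigElem_other x (by omega) (by omega)
  · intro x j h1
    have h2 := reg_bigElem_natAbs_sub_one (r := r) (i := i) (Y := Y) x (by omega) (by omega)
    rw [if_pos (by omega), const_zero, Matrix.zero_mulVec, zero_add] at h2
    rw [show j = i.natAbs - 1 by omega, h2]
    congr 1
    omega

theorem isGate_fiedlerS (R : Realization m n r) {i : ℤ} (h : 0 ≤ i) (h' : i < m) :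
    IsGate i (R.fiedlerS i) := by
  lift i to ℕ using h
  constructor
  · intro x j h1 h2
    exact R.reg_fiedlerS_other x (by omega) (by omega)
  · intro x j h1
    have h2 := R.reg_fiedlerS_pred x (i := i) (by omega) (by omega)
    rw [show j = i - 1 by omega, h2]
    congr 1
    omega

theorem const_prod_cons_mulVec {ι : Type*} [Fintype ι] [DecidableEq ι] (M : Matrix ι ι ℂ)
    (L : List (Matrix ι ι ℂ)) (x : ι → ℂ[X]) :
    (const (M :: L).prod).mulVec x = (const M).mulVec ((const L.prod).mulVec x) := by
  rw [List.prod_cons, const_mul, Matrix.mulVec_mulVec]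

/-- The product is read from its outermost factor inwards while following one block. The head `p`
prepended to the tuple stands for the block being followed. By the property `SuccBetween` the next
factor does not have index `p`, the only one that would mix the block. Index `p + 1` moves attention
to block `p + 1`; every other index leaves block `p` alone. This is exactly the recursion of
`greedyRun`. -/
theorem reg_gates_greedyRun
    (L : List (ℤ × Matrix ((Fin m × Fin n) ⊕ Fin r) ((Fin m × Fin n) ⊕ Fin r) ℂ))
    (hL : ∀ q ∈ L, IsGate q.1 q.2) (p : ℕ) (hp : SuccBetween ((p : ℤ) :: L.map Prod.fst))
    (x : (Fin m × Fin n) ⊕ Fin r → ℂ[X]) :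
    reg ((const (L.map Prod.snd).prod).mulVec x) p = reg x (greedyRun p (L.map Prod.fst)) := by
  induction L generalizing p with
  | nil => simp [greedyRun]
  | cons q L ih =>
    have hq := hL q (by simp)
    have hL' : ∀ q ∈ L, IsGate q.1 q.2 := fun q hq => hL q (by simp [hq])
    rw [List.map_cons, const_prod_cons_mulVec, List.map_cons, greedyRun]
    rw [List.map_cons] at hp
    split_ifs with h
    · rw [hq.pred _ p h.symm]
      apply ih hL'
      rw [Nat.cast_succ, ← h]
      exact hp.of_append (l := [(p : ℤ)])
    · rw [hq.other _ p hp.ne.symm (Ne.symm h)]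
      exact ih hL' p (hp.erase_second h)

end Gates

/-! ### Intermediate values in the action of a permutation of Fiedler factors. -/

namespace Realization

variable {m n r : ℕ} (R : Realization m n r)

/-- The action of a product of Fiedler matrices of the system matrix on polynomial vectors. -/
noncomputable def act (t : List ℤ) (x : (Fin m × Fin n) ⊕ Fin r → ℂ[X]) :
    (Fin m × Fin n) ⊕ Fin r → ℂ[X] :=
  (const (R.fiedlerSProd t)).mulVec x

theorem act_append (s t : List ℤ) (x : (Fin m × Fin n) ⊕ Fin r → ℂ[X]) :
    R.act (s ++ t) x = R.act s (R.act t x) := by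
  simp [act, fiedlerSProd, const_mul, Matrix.mulVec_mulVec]

theorem act_cons (i : ℤ) (t : List ℤ) (x : (Fin m × Fin n) ⊕ Fin r → ℂ[X]) :
    R.act (i :: t) x = (const (R.fiedlerS i)).mulVec (R.act t x) := by
  simp [act, fiedlerSProd, const_mul, Matrix.mulVec_mulVec]

theorem reg_act {t : List ℤ} (ht : ∀ i ∈ t, 0 ≤ i ∧ i < m) {j : ℕ} (h1 : (j : ℤ) ∉ t)
    (h2 : (j : ℤ) + 1 ∉ t) (x : (Fin m × Fin n) ⊕ Fin r → ℂ[X]) :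
    reg (R.act t x) j = reg x j := by
  induction t with
  | nil => simp [act, fiedlerSProd]
  | cons i t ih =>
    simp only [List.mem_cons, not_or] at h1 h2
    have hi := ht i (by simp)
    rw [act_cons, (isGate_fiedlerS R hi.1 hi.2).other _ j h1.1 h2.1]
    exact ih (fun k hk => ht k (by simp [hk])) h1.2 h2.2

theorem statePart_act {t : List ℤ} (ht : ∀ i ∈ t, 0 < i)
    (x : (Fin m × Fin n) ⊕ Fin r → ℂ[X]) : statePart (R.act t x) = statePart x := by
  induction t with
  | nil => simp [act, fiedlerSProd]
  | cons i t ih =>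
    have hi := ht i (by simp)
    lift i to ℕ using hi.le
    rw [act_cons, R.statePart_fiedlerS_pos _ (by omega)]
    exact ih fun k hk => ht k (by simp [hk])

/-- The intermediate values in the action of a permutation `α` of `{0, …, m - 1}`: `a j` is block
`j` before, and `a' j` is block `j` after the factor of index `j` is applied. -/
theorem exists_wires (hm : 0 < m) {α : List ℤ} (hα : IsPermutationOf α 0 (m - 1))
    (y : (Fin m × Fin n) ⊕ Fin r → ℂ[X]) :
    ∃ a a' : ℕ → Fin n → ℂ[X],
      (∀ l s, α = l ++ 0 :: s → a 0 = reg (R.act s y) 0) ∧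
      a' 0 = -(const (R.coeff 0)).mulVec (a 0) - (const R.C).mulVec (statePart y) ∧
      statePart (R.act α y) = -(const R.B).mulVec (a 0) - (const R.A).mulVec (statePart y) ∧
      a (m - 1) = reg y (m - 1) ∧ reg (R.act α y) (m - 1) = a' (m - 1) ∧
      (∀ j : ℕ, j + 1 < m → ¬ [(j : ℤ) + 1, j].Sublist α → a j = a (j + 1) ∧
        a' (j + 1) = reg y j - (const (R.coeff (j + 1))).mulVec (a (j + 1)) ∧
        reg (R.act α y) j = a' j) ∧
      (∀ j : ℕ, j + 1 < m → [(j : ℤ) + 1, j].Sublist α → a j = reg y j ∧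
        a' (j + 1) = a' j - (const (R.coeff (j + 1))).mulVec (a (j + 1)) ∧
        reg (R.act α y) j = a (j + 1)) := by
  have hnd := hα.1
  have hmem : ∀ j : ℕ, j < m → (j : ℤ) ∈ α := fun j hj => (hα.2 j).2 (by omega)
  have hb : ∀ i ∈ α, 0 ≤ i ∧ i < m := fun i hi => by have := (hα.2 i).1 hi; omega
  -- The dummy split for `j ≥ m` makes the chosen `l` and `s` total functions of `j`.
  have hex : ∀ j : ℕ, ∃ l s, j < m → α = l ++ (j : ℤ) :: s := by
    intro j
    by_cases hj : j < m
    · obtain ⟨l, s, h⟩ := List.append_of_mem (hmem j hj)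
      exact ⟨l, s, fun _ => h⟩
    · exact ⟨[], [], fun h => absurd h hj⟩
  choose l s hls using hex
  have huniq : ∀ j : ℕ, j < m → ∀ l' s', α = l' ++ (j : ℤ) :: s' → s j = s' := by
    intro j hj l' s' h
    have h1 := hls j hj
    have h2 : (j : ℤ) ∉ l j ∧ (j : ℤ) ∉ s j := by
      rw [h1] at hnd
      grind [List.nodup_append, List.nodup_cons]
    rw [h1] at h
    exact ((List.append_cons_inj_of_notMem h2.1 h2.2).1 h).2.2
  have hsub : ∀ {l' s'}, α = l' ++ s' →
      (∀ i ∈ l', 0 ≤ i ∧ i < (m : ℤ)) ∧ ∀ i ∈ s', 0 ≤ i ∧ i < (m : ℤ) := by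
    intro l' s' h
    exact ⟨fun i hi => hb i (by simp [h, hi]), fun i hi => hb i (by simp [h, hi])⟩
  -- Products act from the right, so `s j` is what has already acted when factor `j` is reached.
  refine ⟨fun j => reg (R.act (s j) y) j, fun j => reg (R.act ((j : ℤ) :: s j) y) j,
    ?_, ?_, ?_, ?_, ?_, ?_, ?_⟩
  · intro l' s' h
    simp only [huniq 0 hm l' s' h]
  · have h1 := hls 0 hm
    have h2 := (hsub h1).2
    simp only [act_cons, Nat.cast_zero]
    rw [R.reg_fiedlerS_zero _ hm, R.statePart_act]
    intro i hi
    rw [h1] at hnd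
    have h3 : (0 : ℤ) ∉ s 0 := by grind [List.nodup_append, List.nodup_cons]
    have h4 := h2 i (by simp [hi])
    rcases h4.1.eq_or_lt with rfl | h5
    · exact absurd hi h3
    · exact h5
  · have h1 := hls 0 hm
    have h2 := hsub h1
    rw [h1] at hnd
    have h3 : (0 : ℤ) ∉ s 0 ∧ (0 : ℤ) ∉ l 0 := by grind [List.nodup_append, List.nodup_cons]
    have h4 : ∀ i ∈ s 0, 0 < i := fun i hi =>
      lt_of_le_of_ne (h2.2 i (by simp [hi])).1 fun h0 => h3.1 (h0 ▸ hi)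
    have h5 : ∀ i ∈ l 0, 0 < i := fun i hi =>
      lt_of_le_of_ne (h2.1 i (by simp [hi])).1 fun h0 => h3.2 (h0 ▸ hi)
    conv_lhs => rw [h1]
    rw [act_append, act_cons, R.statePart_act h5, Nat.cast_zero, R.statePart_fiedlerS_zero _ hm,
      R.statePart_act h4]
  · have h1 := hls (m - 1) (by omega)
    have h2 := (hsub h1).2
    rw [h1] at hnd
    refine R.reg_act (fun i hi => h2 i (by simp [hi])) ?_ ?_ y
    · grind [List.nodup_append, List.nodup_cons]
    · intro h
      have := h2 _ (List.mem_cons_of_mem _ h)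
      omega
  · have h1 := hls (m - 1) (by omega)
    have h2 := (hsub h1).1
    conv_lhs => rw [h1]
    rw [h1] at hnd
    rw [act_append, R.reg_act h2]
    · grind [List.nodup_append, List.nodup_cons]
    · intro h
      have := h2 _ h
      omega
  · intro j hj hinv
    rcases exists_split_pair (hmem j (by omega)) (hmem (j + 1) hj) (by omega) with
      ⟨l', s₁, s₂, h⟩ | ⟨l', s₁, s₂, h⟩
    · have e1 := huniq j (by omega) _ _ h
      have e2 := huniq (j + 1) hj (l' ++ (j : ℤ) :: s₁) s₂ (by simp [h])
      have hb' := hsub h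
      have hbs₁ : ∀ i ∈ s₁, 0 ≤ i ∧ i < (m : ℤ) := fun i hi => hb'.2 i (by simp [hi])
      have hbs₂ : ∀ i ∈ s₂, 0 ≤ i ∧ i < (m : ℤ) := fun i hi => hb'.2 i (by simp [hi])
      -- Block `j` can change only at the factors `j` and `j + 1`, each of which occurs once. It
      -- therefore stays fixed through `l'`, `s₁` and `s₂`; here factor `j + 1` acts first and hands
      -- its incoming block to block `j`.
      have hn : ((j : ℤ) ∉ l' ∧ (j : ℤ) ∉ s₁ ∧ (j : ℤ) ∉ s₂) ∧
          ((j : ℤ) + 1 ∉ l' ∧ (j : ℤ) + 1 ∉ s₁ ∧ (j : ℤ) + 1 ∉ s₂) := by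
        rw [h] at hnd
        push_cast at hnd
        grind [List.nodup_append, List.nodup_cons]
      simp only [e1, e2]
      refine ⟨?_, ?_, ?_⟩
      · rw [act_append, R.reg_act hbs₁ hn.1.2.1 hn.2.2.1, act_cons]
        exact R.reg_fiedlerS_pred _ (by omega) hj
      · rw [act_cons, R.reg_fiedlerS_self _ (by omega) hj, Nat.add_sub_cancel,
          R.reg_act hbs₂ hn.1.2.2 hn.2.2.2]
      · conv_lhs => rw [h]
        rw [act_append, R.reg_act hb'.1 hn.1.1 hn.2.1]
    · exfalso
      apply hinv
      rw [h]
      exact_mod_cast pair_sublist _ _ _ _ _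
  · intro j hj hinv
    rcases exists_split_pair (hmem j (by omega)) (hmem (j + 1) hj) (by omega) with
      ⟨l', s₁, s₂, h⟩ | ⟨l', s₁, s₂, h⟩
    · exfalso
      rw [h] at hinv hnd
      exact not_pair_sublist hnd (by exact_mod_cast hinv)
    · have e1 := huniq (j + 1) hj _ _ h
      have e2 := huniq j (by omega) (l' ++ ((j + 1 : ℕ) : ℤ) :: s₁) s₂ (by simp [h])
      have hb' := hsub h
      have hbs₁ : ∀ i ∈ s₁, 0 ≤ i ∧ i < (m : ℤ) := fun i hi => hb'.2 i (by simp [hi])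
      have hbs₂ : ∀ i ∈ s₂, 0 ≤ i ∧ i < (m : ℤ) := fun i hi => hb'.2 i (by simp [hi])
      -- Opposite order: factor `j` acts on the original block `j`, and its output enters factor `j
      -- + 1`.
      have hn : ((j : ℤ) ∉ l' ∧ (j : ℤ) ∉ s₁ ∧ (j : ℤ) ∉ s₂) ∧
          ((j : ℤ) + 1 ∉ l' ∧ (j : ℤ) + 1 ∉ s₁ ∧ (j : ℤ) + 1 ∉ s₂) := by
        rw [h] at hnd
        push_cast at hnd
        grind [List.nodup_append, List.nodup_cons]
      simp only [e1, e2]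
      refine ⟨?_, ?_, ?_⟩
      · exact R.reg_act hbs₂ hn.1.2.2 hn.2.2.2 y
      · rw [act_cons, R.reg_fiedlerS_self _ (by omega) hj, Nat.add_sub_cancel, act_append,
          R.reg_act hbs₁ hn.1.2.1 hn.2.2.1]
      · conv_lhs => rw [h]
        rw [act_append, R.reg_act hb'.1 hn.1.1 hn.2.1, act_cons]
        exact R.reg_fiedlerS_pred _ (by omega) hj

end Realization

/-! ### Powers of λ along the wires and Horner partial sums; `P j` marks an inversion at `j`. -/

section Horner

theorem count_not_add_count (P : ℕ → Prop) [DecidablePred P] (j : ℕ) :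
    Nat.count (fun k => ¬ P k) j + Nat.count P j = j := by
  induction j with
  | zero => simp
  | succ j ih =>
    rw [Nat.count_succ, Nat.count_succ]
    by_cases h : P j <;> simp [h] <;> omega

variable {V : Type*} [AddCommGroup V] [Module ℂ[X] V] {m : ℕ} {P : ℕ → Prop} [DecidablePred P]
  {a a' y : ℕ → V} {c : V} {A : ℕ → V →ₗ[ℂ[X]] V}

theorem wires_eq_pow_smul_of_up (hc : ∀ j, j + 1 < m → ¬ P j → a j = a (j + 1))
    (hi : ∀ j, j + 1 < m → P j → (X : ℂ[X]) • a j = a (j + 1)) {j : ℕ} (hj : j < m) :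
    a j = (X ^ Nat.count P j : ℂ[X]) • a 0 := by
  induction j with
  | zero => simp
  | succ j ih =>
    rw [Nat.count_succ]
    by_cases h : P j
    · rw [if_pos h, pow_succ', mul_smul, ← ih (by omega), hi j hj h]
    · rw [if_neg h, add_zero, ← ih (by omega), hc j hj h]

/-- Counterpart of `wires_eq_pow_smul_of_up` for a vector built from `u`: the values at inversions
and at the top are prescribed, and consecutions pass them downwards without changing the exponent.
-/
theorem wires_eq_pow_smul_of_down {u : V} (hc : ∀ j, j + 1 < m → ¬ P j → a j = a (j + 1))
    (hi : ∀ j, j + 1 < m → P j → a j = (X ^ Nat.count P j : ℂ[X]) • u)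
    (ht : a (m - 1) = (X ^ Nat.count P (m - 1) : ℂ[X]) • u) {j : ℕ} (hj : j < m) :
    a j = (X ^ Nat.count P j : ℂ[X]) • u := by
  obtain ⟨k, rfl⟩ : ∃ k, j = m - 1 - k := ⟨m - 1 - j, by omega⟩
  induction k with
  | zero => exact ht
  | succ k ih =>
    by_cases hk : k < m - 1
    · by_cases h : P (m - 1 - (k + 1))
      · exact hi _ (by omega) h
      · have e : m - 1 - (k + 1) + 1 = m - 1 - k := by omega
        rw [hc _ (by omega) h, e, ih (by omega), ← e, Nat.count_succ, if_neg h, add_zero]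
    -- Past the bottom, truncated subtraction repeats index 0.
    · rw [show m - 1 - (k + 1) = m - 1 - k by omega]
      exact ih (by omega)

/-- Each step adds one term to the Horner sum. Hypothesis `hy` is an implication so that one
induction serves both directions: for a given null vector its conclusion follows from the premise
and the pencil equation, and for a constructed vector it holds outright. -/
theorem pow_smul_wires' {u : V} (h0 : a' 0 = -A 0 (a 0) - c)
    (ha : ∀ j, j < m → a j = (X ^ Nat.count P j : ℂ[X]) • u)
    (hc : ∀ j, j + 1 < m → ¬ P j → a' (j + 1) = y j - A (j + 1) (a (j + 1)))
    (hi : ∀ j, j + 1 < m → P j → a' (j + 1) = a' j - A (j + 1) (a (j + 1)))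
    (hy : ∀ j, j + 1 < m → ¬ P j →
      (X ^ Nat.count (fun k => ¬ P k) j : ℂ[X]) • a' j =
        -(∑ k ∈ Finset.range (j + 1), (X ^ k : ℂ[X]) • A k u) - c →
      (X ^ (Nat.count (fun k => ¬ P k) j + 1) : ℂ[X]) • y j =
        -(∑ k ∈ Finset.range (j + 1), (X ^ k : ℂ[X]) • A k u) - c)
    {j : ℕ} (hj : j < m) :
    (X ^ Nat.count (fun k => ¬ P k) j : ℂ[X]) • a' j =
      -(∑ k ∈ Finset.range (j + 1), (X ^ k : ℂ[X]) • A k u) - c := by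
  induction j with
  | zero =>
    have := ha 0 hj
    simp only [Nat.count_zero, pow_zero, one_smul] at this
    simp [h0, this]
  | succ j ih =>
    -- Consecutions and inversions below `j + 1` together number `j + 1`, which is the right power
    -- for `A (j + 1)`.
    have e : (X ^ Nat.count (fun k => ¬ P k) (j + 1) : ℂ[X]) • A (j + 1) (a (j + 1)) =
        (X ^ (j + 1) : ℂ[X]) • A (j + 1) u := by
      rw [ha _ hj, map_smul, smul_smul, ← pow_add, count_not_add_count]
    rw [Finset.sum_range_succ]
    by_cases h : P j
    · rw [hi j hj h, smul_sub, e, Nat.count_succ, if_neg (not_not.2 h), add_zero, ih (by omega)]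
      abel
    · rw [hc j hj h, smul_sub, e, Nat.count_succ, if_pos h, hy j hj h (ih (by omega))]
      abel

end Horner

/-! ### Degrees of vector polynomials under multiplication by powers of λ. -/

section Degrees

theorem X_pow_smul_cancel {ι : Type*} {c : ℕ} {v w : ι → ℂ[X]}
    (h : (X ^ c : ℂ[X]) • v = (X ^ c : ℂ[X]) • w) : v = w :=
  smul_right_injective _ (pow_ne_zero c X_ne_zero) h

theorem natDegree_le_of_X_pow_smul_le {ι : Type*} {v : ι → ℂ[X]} {c d : ℕ}
    (h : ∀ k, (((X ^ c : ℂ[X]) • v) k).natDegree ≤ c + d) (k : ι) : (v k).natDegree ≤ d := by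
  by_cases h0 : v k = 0
  · simp [h0]
  · have := h k
    rw [Pi.smul_apply, smul_eq_mul, mul_comm, natDegree_mul_X_pow _ h0] at this
    omega

variable {κ : Type*} [Fintype κ]

theorem exists_natDegree_eq_vecDegree {v : κ → ℂ[X]} (hv : v ≠ 0) :
    ∃ k, v k ≠ 0 ∧ (v k).natDegree = vecDegree v := by
  obtain ⟨k₀, hk₀⟩ := Function.ne_iff.1 hv
  obtain ⟨k, -, hk⟩ := Finset.exists_mem_eq_sup Finset.univ ⟨k₀, Finset.mem_univ k₀⟩
    fun k => (v k).natDegree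
  by_cases h : v k = 0
  -- If the supremum is attained at a zero entry it is 0, and any nonzero entry attains it too.
  · refine ⟨k₀, hk₀, le_antisymm (natDegree_le_vecDegree v k₀) ?_⟩
    rw [vecDegree, hk, h]
    simp
  · exact ⟨k, h, hk.symm⟩

theorem natDegree_X_pow_smul_le (v : κ → ℂ[X]) (c : ℕ) (k : κ) :
    (((X ^ c : ℂ[X]) • v) k).natDegree ≤ c + vecDegree v := by
  rw [Pi.smul_apply, smul_eq_mul]
  exact natDegree_mul_le.trans
    (add_le_add (natDegree_X_pow_le c) (natDegree_le_vecDegree v k))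

end Degrees

/-! ### Null vectors of the Fiedler pencil and of the system matrix. -/

namespace Realization

variable {m n r : ℕ} (R : Realization m n r)

/-- The Fiedler pencil `λ 𝕄^S_{-m} - 𝕄^S_α`. -/
noncomputable def fiedlerPencil (α : List ℤ) :
    Matrix ((Fin m × Fin n) ⊕ Fin r) ((Fin m × Fin n) ⊕ Fin r) ℂ[X] :=
  (X : ℂ[X]) • const (R.fiedlerS (-m)) - const (R.fiedlerSProd α)

/-- Multiplication by the coefficient `A_k`. -/
noncomputable def coeffMul (k : ℕ) : (Fin n → ℂ[X]) →ₗ[ℂ[X]] (Fin n → ℂ[X]) :=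
  (const (R.coeff k)).mulVecLin

theorem systemMatrix_mulVec (u : Fin n → ℂ[X]) (w : Fin r → ℂ[X]) :
    R.systemMatrix.mulVec (Sum.elim u w) = 0 ↔
      (∑ k ∈ Finset.range (m + 1), (X ^ k : ℂ[X]) • R.coeffMul k u) +
          (const R.C).mulVec w = 0 ∧
        (const R.B).mulVec u + (const R.A).mulVec w = (X : ℂ[X]) • (const R.E).mulVec w := by
  rw [systemMatrix, Matrix.fromBlocks_mulVec]
  simp only [Sum.elim_comp_inl, Sum.elim_comp_inr]
  rw [← Sum.elim_zero_zero, Sum.elim_eq_iff, Matrix.sub_mulVec, Matrix.smul_mulVec,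
    ← add_sub_assoc, sub_eq_zero, polyPart, Matrix.sum_mulVec]
  simp only [Matrix.smul_mulVec, coeffMul, Matrix.mulVecLin_apply]

theorem fiedlerPencil_mulVec_eq_zero_iff (hm : 0 < m) {α : List ℤ}
    (y : (Fin m × Fin n) ⊕ Fin r → ℂ[X]) :
    (R.fiedlerPencil α).mulVec y = 0 ↔
      (∀ j : ℕ, j + 1 < m → reg (R.act α y) j = (X : ℂ[X]) • reg y j) ∧
      reg (R.act α y) (m - 1) = (X : ℂ[X]) • R.coeffMul m (reg y (m - 1)) ∧
      statePart (R.act α y) = -((X : ℂ[X]) • (const R.E).mulVec (statePart y)) := by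
  have e : (R.fiedlerPencil α).mulVec y = 0 ↔
      R.act α y = (X : ℂ[X]) • (const (R.fiedlerS (-m))).mulVec y := by
    rw [fiedlerPencil, Matrix.sub_mulVec, Matrix.smul_mulVec, sub_eq_zero, eq_comm, act]
  have e1 : statePart ((X : ℂ[X]) • (const (R.fiedlerS (-m))).mulVec y) =
      -((X : ℂ[X]) • (const R.E).mulVec (statePart y)) := by
    change (X : ℂ[X]) • statePart ((const (R.fiedlerS (-m))).mulVec y) = _
    rw [R.statePart_fiedlerS_neg_last _ hm, smul_neg]
  have e2 := R.reg_fiedlerS_neg_last y hm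
  rw [e]
  constructor
  · intro h
    refine ⟨fun j hj => ?_, ?_, ?_⟩
    · rw [h, reg_smul, R.reg_fiedlerS_neg_other _ hj]
    · rw [h, reg_smul, e2, coeffMul, Matrix.mulVecLin_apply]
    · rw [h, e1]
  · rintro ⟨h1, h2, h3⟩
    refine ext_reg (fun j hj => ?_) (by rw [h3, e1])
    rw [reg_smul]
    by_cases hj' : j + 1 < m
    · rw [h1 j hj', R.reg_fiedlerS_neg_other _ hj']
    · rw [show j = m - 1 by omega, h2, e2, coeffMul, Matrix.mulVecLin_apply]

/-- A null vector of the system matrix with a nonzero state part has its largest degree in the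
polynomial part only. -/
theorem vecDegree_lt_of_null {u : Fin n → ℂ[X]} {w : Fin r → ℂ[X]}
    (h : (const R.B).mulVec u + (const R.A).mulVec w = (X : ℂ[X]) • (const R.E).mulVec w)
    (hw : w ≠ 0) : vecDegree w < vecDegree u := by
  have hEw : (const R.E).mulVec w ≠ 0 := fun h0 =>
    hw (const_mulVec_injective R.E_nonsingular h0)
  -- An entry of `E w` of degree `deg w` acquires degree `deg w + 1` on the right-hand side; `A w`
  -- cannot reach it, so `B u` must.
  obtain ⟨k, hk, hk'⟩ := exists_natDegree_eq_vecDegree hEw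
  rw [vecDegree_const_mulVec R.E_nonsingular] at hk'
  have h1 := congrArg Polynomial.natDegree (congrFun h k)
  rw [Pi.smul_apply, smul_eq_mul, natDegree_X_mul hk, hk', Pi.add_apply] at h1
  have h2 := natDegree_add_le ((const R.B).mulVec u k) ((const R.A).mulVec w k)
  have h3 := natDegree_const_mulVec_le R.B (natDegree_le_vecDegree u) k
  have h4 := natDegree_const_mulVec_le R.A (natDegree_le_vecDegree w) k
  rw [h1] at h2
  rcases le_max_iff.1 h2 with h5 | h5 <;> omega

open Classical in
/-- The number of `j < k` such that `j + 1` precedes `j` in `α`. -/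
noncomputable def inversionsBelow (α : List ℤ) (k : ℕ) : ℕ :=
  Nat.count (fun j : ℕ => [(j : ℤ) + 1, j].Sublist α) k

theorem vecDegree_sumElim (u : Fin n → ℂ[X]) (w : Fin r → ℂ[X])
    (h : vecDegree w ≤ vecDegree u) : vecDegree (Sum.elim u w) = vecDegree u := by
  apply le_antisymm
  · rw [vecDegree_le_iff]
    rintro (k | k)
    · exact natDegree_le_vecDegree u k
    · exact (natDegree_le_vecDegree w k).trans h
  · rw [vecDegree_le_iff]
    exact fun k => natDegree_le_vecDegree (Sum.elim u w) (Sum.inl k)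

/-- The Horner identity at the top block closes up to the system equation. Nonvanishing of the
recovered vector and the exact degree shift come from the explicit form of every block of `y` in
terms of it and the state part. -/
theorem fiedlerPencil_null {α l s : List ℤ} (hm : 0 < m)
    (hα : IsPermutationOf α 0 (m - 1)) (hs : α = l ++ 0 :: s)
    {y : (Fin m × Fin n) ⊕ Fin r → ℂ[X]}
    (hy : (R.fiedlerPencil α).mulVec y = 0) :
    R.systemMatrix.mulVec (Sum.elim (reg (R.act s y) 0) (statePart y)) = 0 ∧
    (y ≠ 0 → reg (R.act s y) 0 ≠ 0 ∧
      vecDegree y = vecDegree (reg (R.act s y) 0) + inversionsBelow α (m - 1)) := by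
  classical
  obtain ⟨a, a', h1, h2, h3, h4, h5, h6, h7⟩ := R.exists_wires hm hα y
  obtain ⟨k1, k2, k3⟩ := (R.fiedlerPencil_mulVec_eq_zero_iff hm y).1 hy
  rw [← h1 l s hs]
  set u := a 0 with hu
  set w := statePart y with hw
  set P : ℕ → Prop := fun j => [(j : ℤ) + 1, j].Sublist α with hP
  have ha : ∀ j, j < m → a j = (X ^ Nat.count P j : ℂ[X]) • u := by
    intro j hj
    refine wires_eq_pow_smul_of_up (fun j hj h => (h6 j hj h).1) (fun j hj h => ?_) hj
    obtain ⟨q1, q2, q3⟩ := h7 j hj h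
    rw [← q3, k1 j hj, q1]
  have hrec : ∀ j, j + 1 < m → ¬ P j →
      (X ^ Nat.count (fun k => ¬ P k) j : ℂ[X]) • a' j =
        -(∑ k ∈ Finset.range (j + 1), (X ^ k : ℂ[X]) • R.coeffMul k u) -
          (const R.C).mulVec w →
      (X ^ (Nat.count (fun k => ¬ P k) j + 1) : ℂ[X]) • reg y j =
        -(∑ k ∈ Finset.range (j + 1), (X ^ k : ℂ[X]) • R.coeffMul k u) -
          (const R.C).mulVec w := by
    intro j hj h hS
    rw [pow_succ, mul_smul, ← k1 j hj, (h6 j hj h).2.2, hS]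
  have ha' : ∀ j, j < m → _ := fun j hj =>
    pow_smul_wires' (A := R.coeffMul) h2 ha (fun j hj h => (h6 j hj h).2.1)
      (fun j hj h => (h7 j hj h).2.1) hrec hj
  have hnull2 : (const R.B).mulVec u + (const R.A).mulVec w =
      (X : ℂ[X]) • (const R.E).mulVec w := by
    have := h3.symm.trans k3
    rw [← neg_inj, ← this]
    abel
  have hnull : R.systemMatrix.mulVec (Sum.elim u w) = 0 := by
    rw [R.systemMatrix_mulVec]
    refine ⟨?_, hnull2⟩
    -- The output of the last factor is `λ A_m` times the top block; with exponents summing to `m -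
    -- 1`, this supplies the missing term `λ^m A_m u`.
    have e1 := ha' (m - 1) (by omega)
    rw [← h5, k2, ← h4, ha _ (by omega), map_smul, smul_smul, smul_smul,
      ← pow_succ, ← pow_add, show Nat.count (fun k => ¬ P k) (m - 1) + 1 + Nat.count P (m - 1) = m by
        have := count_not_add_count P (m - 1); omega, Nat.sub_add_cancel hm] at e1
    rw [Finset.sum_range_succ, e1]
    abel
  refine ⟨hnull, fun hy0 => ?_⟩
  have hwu : vecDegree w ≤ vecDegree u := by
    by_cases hw0 : w = 0
    · rw [hw0]; simp [vecDegree]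
    · exact (R.vecDegree_lt_of_null hnull2 hw0).le
  have hcons : ∀ j, j + 1 < m → ¬ P j →
      (X ^ (Nat.count (fun k => ¬ P k) j + 1) : ℂ[X]) • reg y j =
        -(∑ k ∈ Finset.range (j + 1), (X ^ k : ℂ[X]) • R.coeffMul k u) -
          (const R.C).mulVec w := fun j hj h => hrec j hj h (ha' j (by omega))
  have hinv : ∀ j, j < m → (P j ∨ j = m - 1) → reg y j = (X ^ Nat.count P j : ℂ[X]) • u := by
    intro j hj h
    rw [← ha j hj]
    by_cases hj' : j + 1 < m
    · exact (h7 j hj' (h.resolve_right (by omega))).1.symm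
    · rw [show j = m - 1 by omega, h4]
  -- If `u = 0`, the strict degree inequality forces `w = 0`, and then every block of `y` vanishes.
  have hu0 : u ≠ 0 := by
    intro h0
    have hw0 : w = 0 := by
      by_contra hw0
      have := R.vecDegree_lt_of_null hnull2 hw0
      simp [h0, vecDegree] at this
    apply hy0
    refine ext_reg (fun j hj => ?_) hw0
    rw [reg_zero]
    by_cases hj' : P j ∨ j = m - 1
    · rw [hinv j hj hj', h0, smul_zero]
    · push Not at hj'
      refine X_pow_smul_cancel (c := Nat.count (fun k => ¬ P k) j + 1) ?_
      rw [hcons j (by omega) hj'.1, h0, hw0]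
      simp
  refine ⟨hu0, ?_⟩
  change vecDegree y = vecDegree u + Nat.count P (m - 1)
  apply le_antisymm
  · have hreg : ∀ j, j < m → ∀ k, (reg y j k).natDegree ≤ vecDegree u + Nat.count P (m - 1) := by
      intro j hj k
      have hmono : Nat.count P j ≤ Nat.count P (m - 1) := Nat.count_monotone P (by omega)
      by_cases hj' : P j ∨ j = m - 1
      · rw [hinv j hj hj']
        have := natDegree_X_pow_smul_le u (Nat.count P j) k
        omega
      · push Not at hj'
        -- The partial sum has degree at most `j + deg u`. Dividing it by a power of λ one larger
        -- than the number of consecutions below `j` leaves at most `deg u` plus the number of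
        -- inversions below `j`.
        have hcnt := count_not_add_count P j
        refine natDegree_le_of_X_pow_smul_le (c := Nat.count (fun k => ¬ P k) j + 1)
          (fun k => ?_) k
        rw [hcons j (by omega) hj'.1, Pi.sub_apply, Pi.neg_apply, Finset.sum_apply]
        refine (natDegree_sub_le _ _).trans (max_le ?_ ?_)
        · rw [natDegree_neg]
          refine natDegree_sum_le_of_forall_le _ _ fun i hi => ?_
          rw [Finset.mem_range] at hi
          refine (natDegree_X_pow_smul_le _ i k).trans ?_
          have : vecDegree (R.coeffMul i u) ≤ vecDegree u :=
            vecDegree_le_iff.2 (natDegree_const_mulVec_le _ (natDegree_le_vecDegree u))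
          omega
        · have := natDegree_const_mulVec_le R.C (natDegree_le_vecDegree w) k
          omega
    rw [vecDegree_le_iff]
    rintro (⟨b, k⟩ | k)
    · rw [apply_inl y]
      exact hreg _ (by omega) k
    · exact (natDegree_le_vecDegree w k).trans (by omega)
  -- The top block is `u` times λ to the total number of inversions, so it attains the bound.
  · obtain ⟨k, hk, hk'⟩ := exists_natDegree_eq_vecDegree hu0
    have e1 := hinv (m - 1) (by omega) (Or.inr rfl)
    have e2 := congrArg Polynomial.natDegree (congrFun e1 k)
    rw [Pi.smul_apply, smul_eq_mul, mul_comm, natDegree_mul_X_pow _ hk, hk',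
      reg_apply _ (by omega)] at e2
    rw [← e2]
    exact natDegree_le_vecDegree y _

/-- The block formulas forced on a null vector are taken as its definition; the system equation is
what makes them polynomial at consecutions. -/
theorem exists_fiedlerPencil_null {α l s : List ℤ} (hm : 0 < m)
    (hα : IsPermutationOf α 0 (m - 1)) (hs : α = l ++ 0 :: s)
    {u : Fin n → ℂ[X]} {w : Fin r → ℂ[X]}
    (h : R.systemMatrix.mulVec (Sum.elim u w) = 0) :
    ∃ y, (R.fiedlerPencil α).mulVec y = 0 ∧ reg (R.act s y) 0 = u ∧ statePart y = w := by
  classical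
  set P : ℕ → Prop := fun j => [(j : ℤ) + 1, j].Sublist α with hP
  obtain ⟨n1, n2⟩ := (R.systemMatrix_mulVec u w).1 h
  set S : ℕ → Fin n → ℂ[X] := fun j =>
    -(∑ k ∈ Finset.range (j + 1), (X ^ k : ℂ[X]) • R.coeffMul k u) - (const R.C).mulVec w with hS
  -- By `P(λ)u + Cw = 0` the negated partial sum is the complementary tail, visibly divisible by
  -- `λ^(j+1)`.
  have hn1 : ∀ j, j ≤ m → S j = ∑ k ∈ Finset.Ico (j + 1) (m + 1), (X ^ k : ℂ[X]) • R.coeffMul k u := by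
    intro j hj
    rw [← Finset.sum_range_add_sum_Ico _ (Nat.succ_le_succ hj)] at n1
    rw [hS]
    simp only
    rw [sub_eq_iff_eq_add, neg_eq_iff_add_eq_zero, ← n1]
    abel
  -- At a consecution the block is the tail divided by `λ^(j+1)` and rescaled by the inversion
  -- count, which is the tail over λ to the consecution count plus one.
  set y : (Fin m × Fin n) ⊕ Fin r → ℂ[X] := ofReg (fun j => (X ^ Nat.count P j : ℂ[X]) •
    if P j ∨ j = m - 1 then u else
      ∑ k ∈ Finset.Ico (j + 1) (m + 1), (X ^ (k - (j + 1)) : ℂ[X]) • R.coeffMul k u) w with hy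
  have hinv : ∀ j, j < m → (P j ∨ j = m - 1) → reg y j = (X ^ Nat.count P j : ℂ[X]) • u := by
    intro j hj h'
    rw [hy, reg_ofReg _ _ hj, if_pos h']
  have hcons : ∀ j, j + 1 < m → ¬ P j →
      (X ^ (Nat.count (fun k => ¬ P k) j + 1) : ℂ[X]) • reg y j = S j := by
    intro j hj h'
    rw [hy, reg_ofReg _ _ (by omega), if_neg (by rw [not_or]; exact ⟨h', by omega⟩), smul_smul,
      ← pow_add, hn1 j (by omega), Finset.smul_sum]
    refine Finset.sum_congr rfl fun k hk => ?_
    rw [Finset.mem_Ico] at hk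
    rw [smul_smul, ← pow_add]
    congr 2
    have := count_not_add_count P j
    omega
  have hyw : statePart y = w := statePart_ofReg _ _
  obtain ⟨a, a', h1, h2, h3, h4, h5, h6, h7⟩ := R.exists_wires hm hα y
  rw [hyw] at h2 h3
  have ha : ∀ j, j < m → a j = (X ^ Nat.count P j : ℂ[X]) • u := by
    intro j hj
    refine wires_eq_pow_smul_of_down (fun j hj h => (h6 j hj h).1) (fun j hj h => ?_) ?_ hj
    · rw [(h7 j hj h).1, hinv j (by omega) (Or.inl h)]
    · rw [h4, hinv _ (by omega) (Or.inr rfl)]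
  have ha0 : a 0 = u := by simpa using ha 0 hm
  have ha' : ∀ j, j < m → (X ^ Nat.count (fun k => ¬ P k) j : ℂ[X]) • a' j = S j := fun j hj =>
    pow_smul_wires' (A := R.coeffMul) h2 ha (fun j hj h => (h6 j hj h).2.1)
      (fun j hj h => (h7 j hj h).2.1) (fun j hj h _ => hcons j hj h) hj
  refine ⟨y, (R.fiedlerPencil_mulVec_eq_zero_iff hm y).2 ⟨?_, ?_, ?_⟩, ?_, hyw⟩
  · intro j hj
    by_cases hPj : P j
    · rw [(h7 j hj hPj).2.2, ha _ hj, hinv j (by omega) (Or.inl hPj), smul_smul, ← pow_succ',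
        Nat.count_succ, if_pos hPj]
    · rw [(h6 j hj hPj).2.2]
      refine X_pow_smul_cancel (c := Nat.count (fun k => ¬ P k) j) ?_
      rw [ha' j (by omega), smul_smul, ← pow_succ, hcons j hj hPj]
  · rw [h5]
    refine X_pow_smul_cancel (c := Nat.count (fun k => ¬ P k) (m - 1)) ?_
    rw [ha' _ (by omega), hinv _ (by omega) (Or.inr rfl), map_smul, smul_smul, smul_smul,
      ← pow_succ, ← pow_add, show Nat.count (fun k => ¬ P k) (m - 1) + 1 + Nat.count P (m - 1) = m by
        have := count_not_add_count P (m - 1); omega, hn1 _ (by omega), Nat.sub_add_cancel hm]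
    simp
  · rw [h3, ha0, hyw, ← n2]
    abel
  · rw [← h1 l s hs, ha0]

end Realization

/-! ### The permutation `α` obtained by moving `τ` across the pencil. -/

section NegRev

theorem mem_negRev {t : List ℤ} {i : ℤ} : i ∈ negRev t ↔ -i ∈ t := by
  simp only [negRev, List.mem_map, List.mem_reverse]
  constructor
  · rintro ⟨j, hj, rfl⟩
    rwa [neg_neg]
  · exact fun h => ⟨-i, h, neg_neg i⟩

theorem nodup_negRev {t : List ℤ} (h : t.Nodup) : (negRev t).Nodup :=
  (List.nodup_reverse.2 h).map neg_injective

theorem negRev_reverse (t : List ℤ) : negRev t.reverse = (negRev t).reverse := by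
  simp [negRev]

theorem isPermutationOf_negRev_append {m h : ℕ} (hh : h < m) {σ τ τl τr : List ℤ}
    (hσ : IsPermutationOf σ 0 h) (hτ : IsPermutationOf τ (-(m : ℤ)) (-(h : ℤ) - 1))
    (hτ' : τ = τl ++ [-(m : ℤ)] ++ τr) :
    IsPermutationOf (negRev τl ++ σ ++ negRev τr) 0 (m - 1) := by
  subst hτ'
  obtain ⟨h1, h2⟩ := hσ
  obtain ⟨h3, h4⟩ := hτ
  have hl : τl.Nodup ∧ τr.Nodup ∧ (∀ i ∈ τl, i ∉ τr) ∧ -(m : ℤ) ∉ τl ∧ -(m : ℤ) ∉ τr := by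
    grind [List.nodup_append, List.nodup_cons]
  have hmem : ∀ i, (i ∈ τl ∨ i ∈ τr) ↔ (-(m : ℤ) < i ∧ i ≤ -(h : ℤ) - 1) := by
    intro i
    have := h4 i
    simp only [List.mem_append, List.mem_singleton] at this
    constructor
    · intro hi
      have hne : i ≠ -(m : ℤ) := by
        rintro rfl
        tauto
      have := this.1 (by tauto)
      omega
    · intro hi
      have hne : i ≠ -(m : ℤ) := by omega
      have := this.2 (by omega)
      tauto
  constructor
  · rw [List.nodup_append', List.nodup_append']
    refine ⟨⟨nodup_negRev hl.1, h1, ?_⟩, nodup_negRev hl.2.1, ?_⟩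
    · intro i hi hi'
      have := (hmem _).1 (Or.inl (mem_negRev.1 hi))
      have := (h2 i).1 hi'
      omega
    · intro i hi hi'
      rw [mem_negRev] at hi'
      rcases List.mem_append.1 hi with hi | hi
      · exact hl.2.2.1 _ (mem_negRev.1 hi) hi'
      · have := (hmem _).1 (Or.inr hi')
        have := (h2 i).1 hi
        omega
  · intro i
    have := hmem (-i)
    rw [List.mem_append, List.mem_append, mem_negRev, mem_negRev, h2 i]
    constructor
    · rintro ((hi | hi) | hi)
      · have := this.1 (Or.inl hi); omega
      · omega
      · have := this.1 (Or.inr hi); omega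
    · intro hi
      by_cases hi' : i ≤ h
      · exact Or.inl (Or.inr ⟨hi.1, hi'⟩)
      · rcases this.2 (by omega) with h5 | h5
        · exact Or.inl (Or.inl h5)
        · exact Or.inr h5

/-- The index `m - 1` never counts, because its successor `m` is not in `α`; so counting below `m -
1` loses nothing. -/
theorem totalInversions_eq {m : ℕ} {α : List ℤ} (hα : IsPermutationOf α 0 (m - 1)) :
    totalInversions α = Realization.inversionsBelow α (m - 1) := by
  classical
  rw [Realization.inversionsBelow, Nat.count_eq_card_filter_range, totalInversions]
  symm
  refine Finset.card_bij (fun j _ => (j : ℤ)) ?_ (fun _ _ _ _ h => by exact_mod_cast h) ?_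
  · intro j hj
    rw [Finset.mem_filter, Finset.mem_range] at hj
    rw [Finset.mem_filter, List.mem_toFinset, hα.2]
    exact ⟨by omega, hj.2⟩
  · intro i hi
    rw [Finset.mem_filter, List.mem_toFinset, hα.2] at hi
    have h1 := (hα.2 (i + 1)).1 (hi.2.subset (by simp))
    refine ⟨i.toNat, ?_, by simp [hi.1.1]⟩
    rw [Finset.mem_filter, Finset.mem_range]
    refine ⟨by omega, ?_⟩
    rw [Int.toNat_of_nonneg hi.1.1]
    exact hi.2

end NegRev

/-! ### Extraction of a block and the state part. -/

section Recovery

variable {m n r : ℕ}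

/-- The matrix that extracts block `k` (counted from 1) and the state part of a vector. -/
noncomputable def recoveryMatrix (m n r : ℕ) (k : ℤ) :
    Matrix (Fin n ⊕ Fin r) ((Fin m × Fin n) ⊕ Fin r) ℂ[X] :=
  Matrix.fromBlocks (blockRow m k 1) 0 0 1

theorem recoveryMatrix_mulVec {g : ℕ} (hg : g < m) (x : (Fin m × Fin n) ⊕ Fin r → ℂ[X]) :
    (recoveryMatrix m n r ((m : ℤ) - g)).mulVec x = Sum.elim (reg x g) (statePart x) := by
  rw [recoveryMatrix, Matrix.fromBlocks_mulVec]
  simp only [Matrix.zero_mulVec, Matrix.one_mulVec, add_zero, zero_add, comp_inr_eq_statePart]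
  congr 1
  funext k
  simp only [Matrix.mulVec, dotProduct, Fintype.sum_prod_type]
  rw [Finset.sum_eq_single ⟨m - 1 - g, by omega⟩]
  · have h5 : ((m - 1 - g : ℕ) : ℤ) + 1 = m - g := by omega
    have h6 : m - 1 - (m - 1 - g) = g := by omega
    simp [blockRow, apply_inl, h5, h6, Matrix.one_apply]
  · intro b _ hb
    have h5 : (b : ℤ) + 1 ≠ m - g := by
      intro h6
      apply hb
      ext
      simp; omega
    simp [blockRow, h5]
  · simp

theorem recoveryMatrix_mul_fromRows {p : ℕ} (k : ℤ) (Zmn : Matrix (Fin m × Fin n) (Fin p) ℂ[X])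
    (Zr : Matrix (Fin r) (Fin p) ℂ[X]) :
    recoveryMatrix m n r k * Matrix.fromRows Zmn Zr =
      Matrix.fromRows (blockRow m k (1 : Matrix (Fin n) (Fin n) ℂ[X]) * Zmn) Zr := by
  simp [recoveryMatrix, Matrix.fromBlocks_mul_fromRows]

theorem reg_bigElemProd {t : List ℤ} {Y : List (Matrix (Fin n) (Fin n) ℂ)} {j : ℕ}
    (ht : ∀ i ∈ t, j ≠ i.natAbs ∧ j + 1 ≠ i.natAbs) (x : (Fin m × Fin n) ⊕ Fin r → ℂ[X]) :
    reg ((const (bigElemProd m r t Y)).mulVec x) j = reg x j := by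
  rw [bigElemProd]
  induction t generalizing Y with
  | nil => simp
  | cons i t ih =>
    rcases Y with _ | ⟨Y, Ys⟩
    · simp
    · rw [List.zipWith_cons_cons, const_prod_cons_mulVec,
        reg_bigElem_other _ (ht i (by simp)).1 (ht i (by simp)).2]
      exact ih fun k hk => ht k (by simp [hk])

theorem statePart_bigElemProd (t : List ℤ) (Y : List (Matrix (Fin n) (Fin n) ℂ))
    (x : (Fin m × Fin n) ⊕ Fin r → ℂ[X]) :
    statePart ((const (bigElemProd m r t Y)).mulVec x) = statePart x := by
  rw [bigElemProd]
  induction t generalizing Y with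
  | nil => simp
  | cons i t ih =>
    rcases Y with _ | ⟨Y, Ys⟩
    · simp
    · rw [List.zipWith_cons_cons, const_prod_cons_mulVec, statePart_bigElem]
      exact ih Ys

theorem reg_act_bigElemProd (R : Realization m n r) {s t : List ℤ}
    {Y : List (Matrix (Fin n) (Fin n) ℂ)} (hY : Y.length = t.length)
    (hs : ∀ i ∈ s, 0 ≤ i ∧ i < m) (ht : ∀ i ∈ t, 0 ≤ i ∧ i < m) {p : ℕ}
    (h : SuccBetween ((p : ℤ) :: (s ++ t))) (x : (Fin m × Fin n) ⊕ Fin r → ℂ[X]) :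
    reg (R.act s ((const (bigElemProd m r t Y)).mulVec x)) p = reg x (greedyRun p (s ++ t)) := by
  set L : List (ℤ × Matrix ((Fin m × Fin n) ⊕ Fin r) ((Fin m × Fin n) ⊕ Fin r) ℂ) :=
    s.map (fun i => (i, R.fiedlerS i)) ++ (t.zip Y).map (fun q => (q.1, bigElem m r q.1 q.2))
    with hL
  have h1 : L.map Prod.fst = s ++ t := by
    rw [hL, List.map_append, List.map_map, List.map_map]
    congr 1
    · simp [Function.comp_def]
    · change (t.zip Y).map Prod.fst = t
      exact List.map_fst_zip hY.ge
  have h2 : (L.map Prod.snd).prod = R.fiedlerSProd s * bigElemProd m r t Y := by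
    rw [hL, List.map_append, List.map_map, List.map_map, List.prod_append, bigElemProd,
      Realization.fiedlerSProd, ← List.map_uncurry_zip_eq_zipWith]
    rfl
  have h3 : ∀ q ∈ L, IsGate q.1 q.2 := by
    intro q hq
    rw [hL, List.mem_append, List.mem_map, List.mem_map] at hq
    rcases hq with ⟨i, hi, rfl⟩ | ⟨⟨i, Z⟩, hi, rfl⟩
    · exact isGate_fiedlerS R (hs i hi).1 (hs i hi).2
    · have := ht i (List.of_mem_zip hi).1
      exact isGate_bigElem this.1 this.2 Z
  have := reg_gates_greedyRun L h3 p (by rwa [h1]) x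
  rw [h1, h2, const_mul, ← Matrix.mulVec_mulVec] at this
  exact this

end Recovery

/-! ### Factoring the pencil through a Fiedler pencil. -/

namespace Realization

variable {m n r : ℕ} (R : Realization m n r)

theorem fiedlerSProd_append (s t : List ℤ) :
    R.fiedlerSProd (s ++ t) = R.fiedlerSProd s * R.fiedlerSProd t := by
  simp [fiedlerSProd]

theorem fiedlerS_mul_neg {i : ℤ} (h : -(m : ℤ) < i) (h' : i < 0) :
    R.fiedlerS i * R.fiedlerS (-i) = 1 := by
  obtain ⟨k, rfl⟩ : ∃ k : ℕ, i = -k := ⟨i.natAbs, by omega⟩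
  rw [R.fiedlerS_neg (by omega) (by omega), neg_neg]
  exact Matrix.nonsing_inv_mul _ (isUnit_iff_ne_zero.2 (R.det_fiedlerS_pos (by omega) (by omega)))

theorem fiedlerSProd_mul_negRev {t : List ℤ} (ht : ∀ i ∈ t, -(m : ℤ) < i ∧ i < 0) :
    R.fiedlerSProd t * R.fiedlerSProd (negRev t) = 1 := by
  induction t with
  | nil => simp [fiedlerSProd, negRev]
  | cons i t ih =>
    have h1 : negRev (i :: t) = negRev t ++ [-i] := by simp [negRev]
    have h2 : R.fiedlerSProd [-i] = R.fiedlerS (-i) := by simp [fiedlerSProd]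
    have h3 : R.fiedlerSProd (i :: t) = R.fiedlerS i * R.fiedlerSProd t := by simp [fiedlerSProd]
    have hi := ht i (by simp)
    rw [h1, fiedlerSProd_append, h2, h3, Matrix.mul_assoc, ← Matrix.mul_assoc (R.fiedlerSProd t),
      ih fun k hk => ht k (by simp [hk]), Matrix.one_mul, R.fiedlerS_mul_neg hi.1 hi.2]

theorem fiedlerSProd_negRev_mul {t : List ℤ} (ht : ∀ i ∈ t, -(m : ℤ) < i ∧ i < 0) :
    R.fiedlerSProd (negRev t) * R.fiedlerSProd t = 1 :=
  mul_eq_one_comm.1 (R.fiedlerSProd_mul_negRev ht)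

theorem fiedlerPencil_factor {τl τr : List ℤ} (σ : List ℤ)
    (hl : ∀ i ∈ τl, -(m : ℤ) < i ∧ i < 0) (hr : ∀ i ∈ τr, -(m : ℤ) < i ∧ i < 0) :
    (X : ℂ[X]) • const (R.fiedlerSProd (τl ++ [-(m : ℤ)] ++ τr)) - const (R.fiedlerSProd σ) =
      const (R.fiedlerSProd τl) * R.fiedlerPencil (negRev τl ++ σ ++ negRev τr) *
        const (R.fiedlerSProd τr) := by
  have h1 : R.fiedlerSProd [-(m : ℤ)] = R.fiedlerS (-m) := by simp [fiedlerSProd]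
  have h2 : const (R.fiedlerSProd τl) * const (R.fiedlerSProd (negRev τl)) = 1 := by
    rw [← const_mul, R.fiedlerSProd_mul_negRev hl, const_one]
  have h3 : const (R.fiedlerSProd (negRev τr)) * const (R.fiedlerSProd τr) = 1 := by
    rw [← const_mul, R.fiedlerSProd_negRev_mul hr, const_one]
  rw [fiedlerPencil, Matrix.mul_sub, Matrix.sub_mul]
  simp only [fiedlerSProd_append, h1, const_mul, Matrix.mul_smul, Matrix.smul_mul]
  congr 1
  simp only [Matrix.mul_assoc]
  rw [h3, Matrix.mul_one, ← Matrix.mul_assoc, h2, Matrix.one_mul]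

theorem det_fiedlerSProd_ne_zero {t : List ℤ} (ht : ∀ i ∈ t, -(m : ℤ) < i ∧ i < 0) :
    (R.fiedlerSProd t).det ≠ 0 :=
  Matrix.det_ne_zero_of_right_inverse (R.fiedlerSProd_mul_negRev ht)

end Realization

/-! ### Recovery of right minimal bases. -/

section RightRecovery

variable {m n r : ℕ}

/-- Null vectors `x` of the pencil correspond to null vectors `Q₀ x` of the Fiedler pencil, with
equal degrees. The point is that the intermediate block 0 of `Q₀ x`, which solves the system
equation, is literally a block of `x`. -/
theorem rightMinimalBasis_recovery (R : Realization m n r) {h : ℕ} {σ τ σ₁ σ₂ τ₁ τ₂ : List ℤ}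
    (hidx : IsGFPRIndices m h σ τ σ₁ σ₂ τ₁ τ₂) {X₁ X₂ Y₁ Y₂ : List (Matrix (Fin n) (Fin n) ℂ)}
    (hX₁ : IsNonsingularAssignment m σ₁ X₁) (hX₂ : IsNonsingularAssignment m σ₂ X₂)
    (hY₁ : IsNonsingularAssignment m τ₁ Y₁) (hY₂ : IsNonsingularAssignment m τ₂ Y₂)
    {τl τr : List ℤ} (hτ : τ = τl ++ [-(m : ℤ)] ++ τr) {p : ℕ}
    {Z : Matrix ((Fin m × Fin n) ⊕ Fin r) (Fin p) ℂ[X]}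
    (hZ : IsRightMinimalBasis (pencil R σ τ σ₁ σ₂ τ₁ τ₂ X₁ X₂ Y₁ Y₂) Z) :
    IsRightMinimalBasis R.systemMatrix
        (recoveryMatrix m n r ((m : ℤ) - consecutionsAt 0 (σ ++ σ₂)) * Z) ∧
      ∀ j, colDegree Z j =
        colDegree (recoveryMatrix m n r ((m : ℤ) - consecutionsAt 0 (σ ++ σ₂)) * Z) j +
          totalInversions (negRev τl ++ σ ++ negRev τr) := by
  have hhm := hidx.h_lt
  have hm : 0 < m := by omega
  set α := negRev τl ++ σ ++ negRev τr with hαdef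
  have hα : IsPermutationOf α 0 (m - 1) :=
    isPermutationOf_negRev_append hhm hidx.perm_σ hidx.perm_τ hτ
  have hτmem : ∀ i, (i ∈ τl ∨ i ∈ τr) → -(m : ℤ) < i ∧ i < 0 := by
    intro i hi
    have h1 : -i ∈ α := by
      rw [hαdef, List.mem_append, List.mem_append, mem_negRev, mem_negRev, neg_neg]
      tauto
    have h2 := (hα.2 _).1 h1
    have h3 := (hidx.perm_τ.2 i).1 (by rw [hτ]; simp only [List.mem_append]; tauto)
    omega
  have hl : ∀ i ∈ τl, -(m : ℤ) < i ∧ i < 0 := fun i hi => hτmem i (Or.inl hi)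
  have hr : ∀ i ∈ τr, -(m : ℤ) < i ∧ i < 0 := fun i hi => hτmem i (Or.inr hi)
  obtain ⟨l, s, hσ⟩ := List.append_of_mem ((hidx.perm_σ.2 0).2 ⟨le_rfl, by omega⟩)
  have h0l : (0 : ℤ) ∉ l := by
    have := hidx.perm_σ.1
    rw [hσ] at this
    exact fun h0 => List.disjoint_of_nodup_append this h0 (by simp)
  have hsplit : α = (negRev τl ++ l) ++ 0 :: (s ++ negRev τr) := by
    rw [hαdef, hσ]; simp
  have hs : ∀ i ∈ s, 0 ≤ i ∧ i ≤ (h : ℤ) := fun i hi =>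
    (hidx.perm_σ.2 i).1 (by rw [hσ]; simp [hi])
  set g := greedyRun 0 (s ++ σ₂) with hg
  have hgh : g ≤ h := greedyRun_le (Nat.zero_le h) fun i hi => by
    rcases List.mem_append.1 hi with hi | hi
    · exact (hs i hi).2
    · have := hidx.mem_σ₂ i hi; omega
  have hc : consecutionsAt 0 (σ ++ σ₂) = (g : ℤ) := by
    rw [hσ, List.append_assoc, List.cons_append, consecutionsAt_zero h0l]
  set P₀ := bigElemProd m r τ₁ Y₁ * bigElemProd m r σ₁ X₁ * R.fiedlerSProd τl with hP₀
  set Q₀ := R.fiedlerSProd τr * (bigElemProd m r σ₂ X₂ * bigElemProd m r τ₂ Y₂) with hQ₀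
  have hσ₁ : ∀ i ∈ σ₁, i.natAbs < m ∨ i = -m := fun i hi => by
    have := hidx.mem_σ₁ i hi; omega
  have hσ₂ : ∀ i ∈ σ₂, i.natAbs < m ∨ i = -m := fun i hi => by
    have := hidx.mem_σ₂ i hi; omega
  have hτ₁ : ∀ i ∈ τ₁, i.natAbs < m ∨ i = -m := fun i hi => by
    have := hidx.mem_τ₁ i hi; omega
  have hτ₂ : ∀ i ∈ τ₂, i.natAbs < m ∨ i = -m := fun i hi => by
    have := hidx.mem_τ₂ i hi; omega
  have hPdet : P₀.det ≠ 0 := by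
    rw [hP₀, Matrix.det_mul, Matrix.det_mul]
    exact mul_ne_zero (mul_ne_zero (det_bigElemProd_ne_zero hm hτ₁ hY₁)
      (det_bigElemProd_ne_zero hm hσ₁ hX₁)) (R.det_fiedlerSProd_ne_zero hl)
  have hQdet : Q₀.det ≠ 0 := by
    rw [hQ₀, Matrix.det_mul, Matrix.det_mul]
    exact mul_ne_zero (R.det_fiedlerSProd_ne_zero hr) (mul_ne_zero
      (det_bigElemProd_ne_zero hm hσ₂ hX₂) (det_bigElemProd_ne_zero hm hτ₂ hY₂))
  have hpencil : pencil R σ τ σ₁ σ₂ τ₁ τ₂ X₁ X₂ Y₁ Y₂ =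
      const P₀ * R.fiedlerPencil α * const Q₀ := by
    rw [pencil, hτ, R.fiedlerPencil_factor σ hl hr, hP₀, hQ₀]
    simp only [const_mul, Matrix.mul_assoc]
    rfl
  have hker : ∀ x, (pencil R σ τ σ₁ σ₂ τ₁ τ₂ X₁ X₂ Y₁ Y₂).mulVec x = 0 ↔
      (R.fiedlerPencil α).mulVec ((const Q₀).mulVec x) = 0 := by
    intro x
    rw [hpencil, ← Matrix.mulVec_mulVec, ← Matrix.mulVec_mulVec]
    exact ⟨fun h0 => const_mulVec_injective hPdet h0, fun h0 => by rw [h0, Matrix.mulVec_zero]⟩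
  -- The tail `-rev τr` of `α` cancels the leading factor of `Q₀`, leaving only the assigned
  -- elementary factors.
  have hact : ∀ x, R.act (negRev τr) ((const Q₀).mulVec x) =
      (const (bigElemProd m r σ₂ X₂)).mulVec ((const (bigElemProd m r τ₂ Y₂)).mulVec x) := by
    intro x
    rw [hQ₀, Realization.act, Matrix.mulVec_mulVec, ← const_mul, ← Matrix.mul_assoc,
      R.fiedlerSProd_negRev_mul hr, Matrix.one_mul, const_mul, Matrix.mulVec_mulVec]
  have hreg : ∀ x, reg (R.act (s ++ negRev τr) ((const Q₀).mulVec x)) 0 = reg x g := by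
    intro x
    have h1 := hidx.sip_σ.succBetween
    rw [hσ, show σ₁ ++ (l ++ 0 :: s) ++ σ₂ = (σ₁ ++ l) ++ (0 :: (s ++ σ₂)) by simp] at h1
    have h2 : SuccBetween (((0 : ℕ) : ℤ) :: (s ++ σ₂)) := h1.of_append
    have h3 : ∀ i ∈ s, 0 ≤ i ∧ i < (m : ℤ) := fun i hi => by have := hs i hi; omega
    have h4 : ∀ i ∈ σ₂, 0 ≤ i ∧ i < (m : ℤ) := fun i hi => by have := hidx.mem_σ₂ i hi; omega
    rw [R.act_append, hact, reg_act_bigElemProd R hX₂.1 h3 h4 h2, reg_bigElemProd]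
    -- Indices in `τ₂` have absolute value at least `h + 2`, so they touch only blocks above `h`,
    -- while `g ≤ h`.
    intro i hi
    have := hidx.mem_τ₂ i hi
    omega
  have hstate : ∀ x, statePart ((const Q₀).mulVec x) = statePart x := by
    intro x
    rw [← R.statePart_act (t := negRev τr) (fun i hi => ?_), hact, statePart_bigElemProd,
      statePart_bigElemProd]
    have := hr _ (mem_negRev.1 hi)
    omega
  have hD : ∀ x, (recoveryMatrix m n r ((m : ℤ) - consecutionsAt 0 (σ ++ σ₂))).mulVec x =
      Sum.elim (reg (R.act (s ++ negRev τr) ((const Q₀).mulVec x)) 0)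
        (statePart ((const Q₀).mulVec x)) := by
    intro x
    rw [hc, recoveryMatrix_mulVec (by omega), hreg, hstate]
  rw [totalInversions_eq hα]
  refine hZ.transfer ?_ ?_ ?_ ?_
  · intro x hx
    rw [hD]
    exact (R.fiedlerPencil_null hm hα hsplit ((hker x).1 hx)).1
  · intro x hx hDx
    rw [hD, ← Sum.elim_zero_zero, Sum.elim_eq_iff] at hDx
    by_contra hx0
    exact ((R.fiedlerPencil_null hm hα hsplit ((hker x).1 hx)).2
      fun h0 => hx0 (const_mulVec_injective hQdet h0)).1 hDx.1
  · intro v hv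
    obtain ⟨u, w, rfl⟩ : ∃ u w, v = Sum.elim u w :=
      ⟨v ∘ Sum.inl, v ∘ Sum.inr, (Sum.elim_comp_inl_inr v).symm⟩
    obtain ⟨y, hy, hyu, hyw⟩ := R.exists_fiedlerPencil_null hm hα hsplit hv
    have hQ : (const Q₀).mulVec ((const Q₀⁻¹).mulVec y) = y := by
      rw [Matrix.mulVec_mulVec, ← const_mul, Matrix.mul_nonsing_inv _
        (isUnit_iff_ne_zero.2 hQdet), const_one, Matrix.one_mulVec]
    refine ⟨(const Q₀⁻¹).mulVec y, ?_, ?_⟩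
    · rw [hker, hQ, hy]
    · rw [hD, hQ, hyu, hyw]
  · intro x hx hx0
    obtain ⟨h1, h2⟩ := (R.fiedlerPencil_null hm hα hsplit ((hker x).1 hx)).2
      fun h0 => hx0 (const_mulVec_injective hQdet h0)
    rw [← vecDegree_const_mulVec hQdet x, h2, hD, Realization.vecDegree_sumElim]
    have hnull := (R.fiedlerPencil_null hm hα hsplit ((hker x).1 hx)).1
    by_cases hw : statePart ((const Q₀).mulVec x) = 0
    · rw [hw]; simp [vecDegree]
    · exact (R.vecDegree_lt_of_null ((R.systemMatrix_mulVec _ _).1 hnull).2 hw).le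

end RightRecovery

/-! ### Left minimal bases by transposition. -/

section Transpose

variable {m n r : ℕ}

theorem isLeftMinimalBasis_iff {ι κ : Type*} [Fintype ι] [Fintype κ] {M : Matrix ι κ ℂ[X]} {p : ℕ}
    {Z : Matrix ι (Fin p) ℂ[X]} :
    IsLeftMinimalBasis M Z ↔ IsRightMinimalBasis M.transpose Z := by
  have h : leftNull (toRat M) = rightNull (toRat M.transpose) := by
    ext x
    rw [leftNull, rightNull, LinearMap.mem_ker, LinearMap.mem_ker, Matrix.mulVecLin_apply,
      Matrix.vecMulLinear_apply, ← Matrix.mulVec_transpose]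
    rfl
  rw [IsLeftMinimalBasis, IsRightMinimalBasis, h]

theorem elemBlocks_transpose (i : ℤ) (Y : Matrix (Fin n) (Fin n) ℂ) (a b : Fin m) :
    elemBlocks m i Y.transpose a b = (elemBlocks m i Y b a).transpose := by
  unfold elemBlocks
  by_cases h1 : i = 0
  · simp only [h1, if_true, Matrix.diagonal_apply]
    split_ifs <;> simp_all
  by_cases h2 : i = -(m : ℤ)
  · rw [if_neg h1, if_pos h2, if_neg h1, if_pos h2]
    simp only [Matrix.diagonal_apply]
    split_ifs <;> simp_all
  · simp only [h1, h2, if_false, Matrix.of_apply, apply_ite Matrix.transpose,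
      Matrix.transpose_one, Matrix.transpose_zero]
    grind

theorem elem_transpose (i : ℤ) (Y : Matrix (Fin n) (Fin n) ℂ) :
    (elem m i Y).transpose = elem m i Y.transpose := by
  ext ⟨a, k⟩ ⟨b, l⟩
  simp only [elem, Matrix.transpose_apply, Matrix.comp_apply, elemBlocks_transpose]

theorem bigElem_transpose (i : ℤ) (Y : Matrix (Fin n) (Fin n) ℂ) :
    (bigElem m r i Y).transpose = bigElem m r i Y.transpose := by
  rw [bigElem, bigElem, Matrix.fromBlocks_transpose, Matrix.transpose_zero, Matrix.transpose_zero,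
    Matrix.transpose_one, elem_transpose]

theorem bigElemProd_transpose {t : List ℤ} {Y : List (Matrix (Fin n) (Fin n) ℂ)}
    (h : Y.length = t.length) :
    (bigElemProd m r t Y).transpose =
      bigElemProd m r t.reverse (Y.map Matrix.transpose).reverse := by
  rw [bigElemProd, bigElemProd, Matrix.transpose_list_prod, ← List.reverse_zipWith (by simp [h]),
    List.map_zipWith, List.zipWith_map_right]
  simp only [bigElem_transpose]

theorem IsNonsingularAssignment.transpose_reverse {t : List ℤ}
    {Y : List (Matrix (Fin n) (Fin n) ℂ)} (h : IsNonsingularAssignment m t Y) :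
    IsNonsingularAssignment m t.reverse (Y.map Matrix.transpose).reverse := by
  refine ⟨by simp [h.1], ?_⟩
  intro q hq hq'
  rw [List.zip, ← List.reverse_zipWith (by simp [h.1]), List.mem_reverse, ← List.zip,
    List.zip_map_right, List.mem_map] at hq
  obtain ⟨q', h1, rfl⟩ := hq
  simp only [Prod.map_snd, Matrix.det_transpose]
  exact h.2 q' h1 hq'

namespace Realization

/-- The realization of the transposed rational matrix. -/
def transpose (R : Realization m n r) : Realization m n r where
  coeff k := (R.coeff k).transpose
  A := R.A.transpose
  E := R.E.transpose
  B := R.C.transpose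
  C := R.B.transpose
  E_nonsingular := by rw [Matrix.det_transpose]; exact R.E_nonsingular

variable (R : Realization m n r)

theorem systemMatrix_transpose : R.systemMatrix.transpose = R.transpose.systemMatrix := by
  rw [systemMatrix, systemMatrix, Matrix.fromBlocks_transpose]
  congr 1
  simp [polyPart, transpose, const_transpose, Matrix.transpose_sum]

theorem fiedlerP_transpose (i : ℤ) : (R.fiedlerP i).transpose = R.transpose.fiedlerP i := by
  unfold fiedlerP
  split_ifs <;> simp [elem_transpose, transpose]

theorem fiedlerS_transpose (i : ℤ) : (R.fiedlerS i).transpose = R.transpose.fiedlerS i := by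
  unfold fiedlerS
  split_ifs
  · rw [Matrix.fromBlocks_transpose, fiedlerP_transpose]
    congr 1
  · rw [Matrix.fromBlocks_transpose, fiedlerP_transpose]
    congr 1
  · rw [Matrix.fromBlocks_transpose, fiedlerP_transpose, Matrix.transpose_zero,
      Matrix.transpose_zero, Matrix.transpose_one]
  · rw [Matrix.transpose_nonsing_inv, Matrix.fromBlocks_transpose, fiedlerP_transpose,
      Matrix.transpose_zero, Matrix.transpose_zero, Matrix.transpose_one]

theorem fiedlerSProd_transpose (t : List ℤ) :
    (R.fiedlerSProd t).transpose = R.transpose.fiedlerSProd t.reverse := by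
  rw [fiedlerSProd, fiedlerSProd, Matrix.transpose_list_prod, List.map_map, List.map_reverse]
  congr 3
  funext i
  exact R.fiedlerS_transpose i

/-- Transposition stays within the class of pencils: tuples are reversed, left and right assignments
trade places, and `B`, `C` are swapped in the realization. -/
theorem pencil_transpose {σ τ σ₁ σ₂ τ₁ τ₂ : List ℤ}
    {X₁ X₂ Y₁ Y₂ : List (Matrix (Fin n) (Fin n) ℂ)}
    (hX₁ : X₁.length = σ₁.length) (hX₂ : X₂.length = σ₂.length)
    (hY₁ : Y₁.length = τ₁.length) (hY₂ : Y₂.length = τ₂.length) :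
    (pencil R σ τ σ₁ σ₂ τ₁ τ₂ X₁ X₂ Y₁ Y₂).transpose =
      pencil R.transpose σ.reverse τ.reverse σ₂.reverse σ₁.reverse τ₂.reverse τ₁.reverse
        (X₂.map Matrix.transpose).reverse (X₁.map Matrix.transpose).reverse
        (Y₂.map Matrix.transpose).reverse (Y₁.map Matrix.transpose).reverse := by
  simp only [pencil, Matrix.transpose_mul, Matrix.transpose_sub, Matrix.transpose_smul,
    ← const_transpose, bigElemProd_transpose, fiedlerSProd_transpose, hX₁, hX₂, hY₁, hY₂,
    Matrix.mul_assoc]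

end Realization

theorem IsPermutationOf.reverse {t : List ℤ} {a b : ℤ} (h : IsPermutationOf t a b) :
    IsPermutationOf t.reverse a b :=
  ⟨List.nodup_reverse.2 h.1, fun i => by rw [List.mem_reverse, h.2]⟩

theorem IsGFPRIndices.reverse {h : ℕ} {σ τ σ₁ σ₂ τ₁ τ₂ : List ℤ}
    (hidx : IsGFPRIndices m h σ τ σ₁ σ₂ τ₁ τ₂) :
    IsGFPRIndices m h σ.reverse τ.reverse σ₂.reverse σ₁.reverse τ₂.reverse τ₁.reverse where
  h_lt := hidx.h_lt
  perm_σ := hidx.perm_σ.reverse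
  perm_τ := hidx.perm_τ.reverse
  mem_σ₁ := fun i hi => hidx.mem_σ₂ i (List.mem_reverse.1 hi)
  mem_σ₂ := fun i hi => hidx.mem_σ₁ i (List.mem_reverse.1 hi)
  mem_τ₁ := fun i hi => hidx.mem_τ₂ i (List.mem_reverse.1 hi)
  mem_τ₂ := fun i hi => hidx.mem_τ₁ i (List.mem_reverse.1 hi)
  sip_σ := by simpa using hidx.sip_σ.reverse
  sip_τ := by simpa using hidx.sip_τ.reverse

theorem consecutionsAt_reverse (t : ℤ) (α : List ℤ) :
    consecutionsAt t α.reverse = inversionsAt t α := by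
  have h : ∀ p, (run t p).Sublist α.reverse ↔ (run t p).reverse.Sublist α := fun p => by
    rw [← List.reverse_sublist, List.reverse_reverse]
  simp only [consecutionsAt, inversionsAt, List.mem_reverse, List.length_reverse, h]

theorem totalInversions_reverse (α : List ℤ) :
    totalInversions α.reverse = totalConsecutions α := by
  have h : ∀ i : ℤ, [i + 1, i].Sublist α.reverse ↔ [i, i + 1].Sublist α := fun i => by
    rw [← List.reverse_sublist, List.reverse_reverse]
    rfl
  simp only [totalInversions, totalConsecutions, List.toFinset_reverse, h]

theorem leftMinimalBasis_recovery (R : Realization m n r) {h : ℕ} {σ τ σ₁ σ₂ τ₁ τ₂ : List ℤ}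
    (hidx : IsGFPRIndices m h σ τ σ₁ σ₂ τ₁ τ₂) {X₁ X₂ Y₁ Y₂ : List (Matrix (Fin n) (Fin n) ℂ)}
    (hX₁ : IsNonsingularAssignment m σ₁ X₁) (hX₂ : IsNonsingularAssignment m σ₂ X₂)
    (hY₁ : IsNonsingularAssignment m τ₁ Y₁) (hY₂ : IsNonsingularAssignment m τ₂ Y₂)
    {τl τr : List ℤ} (hτ : τ = τl ++ [-(m : ℤ)] ++ τr) {p : ℕ}
    {Z : Matrix ((Fin m × Fin n) ⊕ Fin r) (Fin p) ℂ[X]}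
    (hZ : IsLeftMinimalBasis (pencil R σ τ σ₁ σ₂ τ₁ τ₂ X₁ X₂ Y₁ Y₂) Z) :
    IsLeftMinimalBasis R.systemMatrix
        (recoveryMatrix m n r ((m : ℤ) - inversionsAt 0 (σ₁ ++ σ)) * Z) ∧
      ∀ j, colDegree Z j =
        colDegree (recoveryMatrix m n r ((m : ℤ) - inversionsAt 0 (σ₁ ++ σ)) * Z) j +
          totalConsecutions (negRev τl ++ σ ++ negRev τr) := by
  rw [isLeftMinimalBasis_iff, R.pencil_transpose hX₁.1 hX₂.1 hY₁.1 hY₂.1] at hZ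
  -- Reversing `τ` interchanges the two sides of `-m`, so the associated permutation becomes the
  -- reverse of `α`.
  have key := rightMinimalBasis_recovery R.transpose hidx.reverse hX₂.transpose_reverse
    hX₁.transpose_reverse hY₂.transpose_reverse hY₁.transpose_reverse
    (τl := τr.reverse) (τr := τl.reverse) (by rw [hτ]; simp) hZ
  rw [← List.reverse_append, consecutionsAt_reverse, negRev_reverse, negRev_reverse,
    List.append_assoc, ← List.reverse_append, ← List.reverse_append, totalInversions_reverse] at key
  rw [isLeftMinimalBasis_iff, R.systemMatrix_transpose]
  exact key

end Transpose

end GFPR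

theorem theorem5p3 {m n r : ℕ} (R : Realization m n r) (hAm : R.coeff m ≠ 0)
    (hmin : R.IsMinimal) (h : ℕ) (σ τ σ₁ σ₂ τ₁ τ₂ : List ℤ)
    (hidx : IsGFPRIndices m h σ τ σ₁ σ₂ τ₁ τ₂)
    (X₁ X₂ Y₁ Y₂ : List (Matrix (Fin n) (Fin n) ℂ))
    (hX₁ : IsNonsingularAssignment m σ₁ X₁) (hX₂ : IsNonsingularAssignment m σ₂ X₂)
    (hY₁ : IsNonsingularAssignment m τ₁ Y₁) (hY₂ : IsNonsingularAssignment m τ₂ Y₂) :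
    (∀ (p : ℕ) (Zmn : Matrix (Fin m × Fin n) (Fin p) ℂ[X]) (Zr : Matrix (Fin r) (Fin p) ℂ[X]),
      (IsRightMinimalBasis (pencil R σ τ σ₁ σ₂ τ₁ τ₂ X₁ X₂ Y₁ Y₂) (Matrix.fromRows Zmn Zr) →
        IsRightMinimalBasis R.systemMatrix
          (Matrix.fromRows
            (blockRow m ((m : ℤ) - consecutionsAt 0 (σ ++ σ₂))
              (1 : Matrix (Fin n) (Fin n) ℂ[X]) * Zmn) Zr)) ∧
      (IsLeftMinimalBasis (pencil R σ τ σ₁ σ₂ τ₁ τ₂ X₁ X₂ Y₁ Y₂) (Matrix.fromRows Zmn Zr) →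
        IsLeftMinimalBasis R.systemMatrix
          (Matrix.fromRows
            (blockRow m ((m : ℤ) - inversionsAt 0 (σ₁ ++ σ))
              (1 : Matrix (Fin n) (Fin n) ℂ[X]) * Zmn) Zr))) ∧
    (∀ τl τr α : List ℤ, τ = τl ++ [-(m : ℤ)] ++ τr → α = negRev τl ++ σ ++ negRev τr →
      ∀ (p : ℕ) (ε : Fin p → ℤ),
        (IsRightMinimalIndices (pencil R σ τ σ₁ σ₂ τ₁ τ₂ X₁ X₂ Y₁ Y₂) ε →
          IsRightMinimalIndices R.systemMatrix fun j => ε j - (totalInversions α : ℤ)) ∧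
        (IsLeftMinimalIndices (pencil R σ τ σ₁ σ₂ τ₁ τ₂ X₁ X₂ Y₁ Y₂) ε →
          IsLeftMinimalIndices R.systemMatrix fun j => ε j - (totalConsecutions α : ℤ))) := by
  constructor
  · intro p Zmn Zr
    have hlt := hidx.h_lt
    -- The recovered basis in part (a) does not involve the splitting of `τ`; it is needed only to
    -- invoke the recovery lemmas.
    obtain ⟨τl, τr, hτ⟩ := List.append_of_mem ((hidx.perm_τ.2 (-m)).2 ⟨le_rfl, by omega⟩)
    rw [← recoveryMatrix_mul_fromRows, ← recoveryMatrix_mul_fromRows]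
    exact ⟨fun hZ => (rightMinimalBasis_recovery R hidx hX₁ hX₂ hY₁ hY₂ (τl := τl) (τr := τr)
        (by rw [hτ]; simp) hZ).1,
      fun hZ => (leftMinimalBasis_recovery R hidx hX₁ hX₂ hY₁ hY₂ (τl := τl) (τr := τr)
        (by rw [hτ]; simp) hZ).1⟩
  · rintro τl τr α hτ rfl p ε
    constructor
    · rintro ⟨Z, hZ, hε⟩
      obtain ⟨h1, h2⟩ := rightMinimalBasis_recovery R hidx hX₁ hX₂ hY₁ hY₂ hτ hZ
      refine ⟨_, h1, fun j => ?_⟩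
      change _ = ε j - _
      rw [← hε j, h2 j]
      push_cast
      ring
    · rintro ⟨Z, hZ, hε⟩
      obtain ⟨h1, h2⟩ := leftMinimalBasis_recovery R hidx hX₁ hX₂ hY₁ hY₂ hτ hZ
      refine ⟨_, h1, fun j => ?_⟩
      change _ = ε j - _
      rw [← hε j, h2 j]
      push_cast
      ring
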